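/- Let $\Gamma$ be an (additively written) discrete abelian group, let $S\subseteq\Gamma$ be a subsemigroup with $0\in S$ and $\Gamma=S-S$, and let $G=\widehat\Gamma$ be the compact dual group, with characters $\chi^c$, $c\in\Gamma$. Let $T_a e_b=e_{a+b}$ ($a,b\in S$) be the shifts on $\ell^2(S)$, let $\mathfrak A=C^*_{red}(S)\subseteq B(\ell^2(S))$ be the $C^*$-algebra they generate, and call finite products of operators $T_a$, $T_a^*$ monomials. Let $K$ be the commutator ideal of $\mathfrak A$, i.e. the closed two-sided ideal generated by the commutators $T_cT_d-T_dT_c$, $c,d\in\Gamma$, where $T_c=T_a^*T_b$ for $c=b-a$, $a,b\in S$. For $f\in C(G)$ let $\rho(f)\in\mathfrak A$ be the operator on $\ell^2(S)\cong H^2(S)=\overline{\mathrm{span}}\{\chi^a:a\in S\}\subseteq L^2(G)$ obtained by compressing multiplication by $f$ to $H^2(S)$. For $N\subseteq\mathfrak A$ write $N^\perp\subseteq\mathfrak A^*$ for its annihilator. For $\xi,\eta\in\mathfrak A^*$, let $\xi\times\eta=(\xi\otimes\eta)\circ\Delta$, where $\Delta\big(\sum_i\lambda_iV_i\big)=\sum_i\lambda_iV_i\otimes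 V_i$ for monomials $V_i$; that is, $\xi\times\eta$ is the element of $\mathfrak A^*$ with $(\xi\times\eta)(V)=\xi(V)\eta(V)$ for every monomial $V$. There is at most one such element; if there is one, we say that $\xi\times\eta$ is defined. (It is defined for all $\xi,\eta$ whenever $\Delta$ extends to a bounded map $\mathfrak A\to\mathfrak A\otimes_{\min}\mathfrak A$, so that $\mathfrak A^*$ is the dual algebra of a compact quantum semigroup.) Then: 1. For all $\xi,\eta\in K^\perp$ the product $\xi\times\eta$ is defined and lies in $K^\perp$. With this product $K^\perp$ is a commutative Banach algebra, and it is isometrically isomorphic to the algebra $M(G)$ of regular complex Borel measures on $G$, with the total variation norm and convolution. The isomorphism $\xi\mapsto\mu_\xi$ satisfies $\xi(\rho(f))=\int_G f\,d\mu_\xi$ for $f\in C(G)$. 2. There is a continuous linear map $\pi:\mathfrak A^*\to K^\perp$ such that the sequence $$0\to\rho(C(G))^\perp\hookrightarrow\mathfrak A^*\xrightarrow{\ \pi\ }K^\perp\cong M(G)\to0$$ is exact and is split by the inclusion $K^\perp\subseteq\mathfrak A^*$, i.e. $\pi|_{K^\perp}=\mathrm{id}$. The splitting is compatible with products: whenever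 $\xi\times\eta$ is defined, $\pi(\xi\times\eta)=\pi(\xi)\times\pi(\eta)$, and $\xi\times\eta\in\rho(C(G))^\perp$ if $\xi$ or $\eta$ lies in $\rho(C(G))^\perp$. -/

import Mathlib

open MeasureTheory
open scoped TensorProduct ENNReal

noncomputable section

namespace SemigroupCstar

/-! ### The reduced semigroup C*-algebra -/

section Reduced

variable {Γ : Type*} [AddCommGroup Γ] (S : AddSubmonoid Γ)

/-- The Hilbert space `ℓ²(S)`. -/
abbrev EllTwo : Type _ := lp (fun _ : S => ℂ) 2

open Classical in
/-- The standard basis vector `e_a` of `ℓ²(S)`. -/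
def basisVec (a : S) : EllTwo S := lp.single 2 a (1 : ℂ)

lemma orthonormal_basisVec : Orthonormal ℂ (basisVec S) := by
  classical
  rw [orthonormal_iff_ite]
  intro a b
  rw [basisVec, basisVec, lp.inner_single_left, lp.single_apply]
  by_cases h : a = b
  · subst h; simp
  · simp [h]

lemma orthonormal_basisVec_add (a : S) : Orthonormal ℂ (fun b : S => basisVec S (a + b)) :=
  (orthonormal_basisVec S).comp (fun b => a + b) (add_right_injective a)

lemma ext_basisVec {A B : EllTwo S →L[ℂ] EllTwo S}
    (h : ∀ x y, inner ℂ (basisVec S x) (A (basisVec S y)) =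
      inner ℂ (basisVec S x) (B (basisVec S y))) : A = B := by
  classical
  refine lp.ext_continuousLinearMap (by simp) fun y => ?_
  refine ContinuousLinearMap.ext_ring ?_
  ext x
  have h1 := h x y
  simp only [basisVec, lp.inner_single_left] at h1
  convert h1 using 1 <;> simp

/-- The isometric shift `T_a` on `ℓ²(S)`, as a bounded operator: `T_a e_b = e_{a + b}`. -/
def shiftOp (a : S) : EllTwo S →L[ℂ] EllTwo S :=
  (orthonormal_basisVec_add S a).orthogonalFamily.linearIsometry.toContinuousLinearMap

lemma shiftOp_basisVec (a b : S) : shiftOp S a (basisVec S b) = basisVec S (a + b) := by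
  classical
  simp [shiftOp, basisVec]

/-- The reduced semigroup C*-algebra: the norm-closed star-subalgebra of `B(ℓ²(S))` generated by
the shifts `T_a`, `a ∈ S` (the unit is `T_0`). -/
def Cred : StarSubalgebra ℂ (EllTwo S →L[ℂ] EllTwo S) :=
  (StarAlgebra.adjoin ℂ (Set.range (shiftOp S))).topologicalClosure

lemma shiftOp_mem (a : S) : shiftOp S a ∈ Cred S :=
  StarSubalgebra.le_topologicalClosure _ (StarAlgebra.subset_adjoin ℂ _ ⟨a, rfl⟩)

/-- The generator `T_a`, as an element of the reduced semigroup C*-algebra. -/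
def gen (a : S) : Cred S := ⟨shiftOp S a, shiftOp_mem S a⟩

/-- The semigroup of monomials: finite products of the operators `T_a` and `T_a^*`. -/
def monomials : Submonoid (Cred S) :=
  Submonoid.closure (Set.range (gen S) ∪ Set.range fun a => star (gen S a))

/-- The operator `T_c = T_a^* T_b` for `c = b - a`. -/
def genDiff (a b : S) : Cred S := star (gen S a) * gen S b

/-- The commutator ideal `K`: the closed two-sided ideal generated by the commutators
`T_c T_d - T_d T_c`, `c, d ∈ S - S`. -/
def commutatorIdeal : Submodule ℂ (Cred S) :=
  (Submodule.span ℂ {X | ∃ (A B : Cred S) (a b a' b' : S),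
    X = A * (genDiff S a b * genDiff S a' b' - genDiff S a' b' * genDiff S a b) * B}
    ).topologicalClosure

variable {S}

/-- The annihilator `N^⊥`, in the Banach space dual, of a subspace `N` of the reduced
semigroup C*-algebra. -/
def annihilator (N : Submodule ℂ (Cred S)) : Submodule ℂ (StrongDual ℂ (Cred S)) where
  carrier := {ξ | ∀ A ∈ N, ξ A = 0}
  zero_mem' := by simp
  add_mem' := by
    intro ξ η hξ hη A hA
    simp [hξ A hA, hη A hA]
  smul_mem' := by
    intro c ξ hξ A hA
    simp [hξ A hA]

variable (S) in
/-- The graph of the comultiplication `Δ (∑ λ_i V_i) = ∑ λ_i V_i ⊗ V_i` (`V_i` monomials) on the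
dense subalgebra of finite linear combinations of monomials. -/
def comultGraph : Submodule ℂ (Cred S × (Cred S ⊗[ℂ] Cred S)) :=
  Submodule.span ℂ {p | ∃ V ∈ monomials S, p = (V, V ⊗ₜ[ℂ] V)}

/-- The functional `ξ ⊗ η` on the algebraic tensor product, `A ⊗ B ↦ ξ(A) η(B)`. -/
def tensorFunctional (ξ η : StrongDual ℂ (Cred S)) : (Cred S ⊗[ℂ] Cred S) →ₗ[ℂ] ℂ :=
  LinearMap.mul' ℂ ℂ ∘ₗ TensorProduct.map ξ.toLinearMap η.toLinearMap

/-- `ζ` is the product `ξ × η = (ξ ⊗ η) ∘ Δ` in the dual space. By density of the span of the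
monomials there is at most one such `ζ` (`IsDualProduct.unique`). It exists for all `ξ, η` as soon
as `Δ` extends to a bounded map from the C*-algebra to its minimal tensor square. -/
def IsDualProduct (ξ η ζ : StrongDual ℂ (Cred S)) : Prop :=
  ∀ p ∈ comultGraph S, ζ p.1 = tensorFunctional ξ η p.2

lemma isDualProduct_iff (ξ η ζ : StrongDual ℂ (Cred S)) :
    IsDualProduct ξ η ζ ↔ ∀ V ∈ monomials S, ζ V = ξ V * η V := by
  constructor
  · intro h V hV
    simpa [tensorFunctional] using h _ (Submodule.subset_span ⟨V, hV, rfl⟩)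
  · intro h p hp
    induction hp using Submodule.span_induction with
    | mem p hp =>
      obtain ⟨V, hV, rfl⟩ := hp
      simpa [tensorFunctional] using h V hV
    | zero => simp
    | add p q _ _ hp hq => simp [hp, hq]
    | smul c p _ hp => simp [hp]

lemma span_monomials_dense (A : Cred S) :
    A ∈ (Submodule.span ℂ (monomials S : Set (Cred S))).topologicalClosure := by
  have hgen : ∀ B ∈ Submonoid.closure (Set.range (shiftOp S) ∪ star (Set.range (shiftOp S))),
      ∃ V ∈ monomials S, (V : EllTwo S →L[ℂ] EllTwo S) = B := by
    intro B hB
    induction hB using Submonoid.closure_induction with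
    | mem B hB =>
      rcases hB with ⟨a, rfl⟩ | ⟨a, ha⟩
      · exact ⟨gen S a, Submonoid.subset_closure (Or.inl ⟨a, rfl⟩), rfl⟩
      · refine ⟨star (gen S a), Submonoid.subset_closure (Or.inr ⟨a, rfl⟩), ?_⟩
        rw [← star_star B, ← ha]; rfl
    | one => exact ⟨1, one_mem _, rfl⟩
    | mul B C _ _ hB hC =>
      obtain ⟨V, hV, rfl⟩ := hB
      obtain ⟨W, hW, rfl⟩ := hC
      exact ⟨V * W, mul_mem hV hW, rfl⟩
  have hspan : ∀ B ∈ Submodule.span ℂ (Submonoid.closure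
      (Set.range (shiftOp S) ∪ star (Set.range (shiftOp S))) : Set (EllTwo S →L[ℂ] EllTwo S)),
      ∃ V ∈ Submodule.span ℂ (monomials S : Set (Cred S)),
        (V : EllTwo S →L[ℂ] EllTwo S) = B := by
    intro B hB
    induction hB using Submodule.span_induction with
    | mem B hB =>
      obtain ⟨V, hV, h⟩ := hgen B hB
      exact ⟨V, Submodule.subset_span hV, h⟩
    | zero => exact ⟨0, zero_mem _, rfl⟩
    | add B C _ _ hB hC =>
      obtain ⟨V, hV, rfl⟩ := hB
      obtain ⟨W, hW, rfl⟩ := hC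
      exact ⟨V + W, add_mem hV hW, rfl⟩
    | smul c B _ hB =>
      obtain ⟨V, hV, rfl⟩ := hB
      exact ⟨c • V, Submodule.smul_mem _ c hV, rfl⟩
  rw [← SetLike.mem_coe, Submodule.topologicalClosure_coe, closure_subtype]
  have hA : (A : EllTwo S →L[ℂ] EllTwo S) ∈
      closure (StarAlgebra.adjoin ℂ (Set.range (shiftOp S)) : Set (EllTwo S →L[ℂ] EllTwo S)) := by
    have : (A : EllTwo S →L[ℂ] EllTwo S) ∈
        (StarAlgebra.adjoin ℂ (Set.range (shiftOp S))).topologicalClosure := A.2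
    rwa [← SetLike.mem_coe, StarSubalgebra.topologicalClosure_coe] at this
  refine closure_mono ?_ hA
  intro B hB
  have hB' : B ∈ Subalgebra.toSubmodule
      (StarAlgebra.adjoin ℂ (Set.range (shiftOp S))).toSubalgebra := hB
  rw [StarAlgebra.adjoin_eq_span] at hB'
  obtain ⟨V, hV, h⟩ := hspan B hB'
  exact ⟨V, hV, h⟩

lemma IsDualProduct.unique {ξ η ζ ζ' : StrongDual ℂ (Cred S)} (h : IsDualProduct ξ η ζ)
    (h' : IsDualProduct ξ η ζ') : ζ = ζ' := by
  rw [isDualProduct_iff] at h h'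
  have hle : (Submodule.span ℂ (monomials S : Set (Cred S))).topologicalClosure ≤
      LinearMap.ker (ζ - ζ').toLinearMap := by
    refine Submodule.topologicalClosure_minimal _ ?_ (ζ - ζ').isClosed_ker
    rw [Submodule.span_le]
    intro V hV
    simp [h V hV, h' V hV]
  ext A
  have := hle (span_monomials_dense A)
  simpa [sub_eq_zero] using this

end Reduced

/-! ### Regular complex Borel measures -/

section RegularMeasure

variable (X : Type*) [TopologicalSpace X] [CompactSpace X] [T2Space X] [MeasurableSpace X]
  [BorelSpace X]

variable {X} in
lemma regular_of_le {μ ν : Measure X} [ν.Regular] (h : μ ≤ ν) : μ.Regular := by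
  have : IsFiniteMeasure ν := ⟨isCompact_univ.measure_lt_top⟩
  have : IsFiniteMeasure μ := isFiniteMeasure_of_le ν h
  have : μ.InnerRegularCompactLTTop := by
    constructor
    rintro A ⟨hA, -⟩ r hr
    obtain ⟨K, hKA, hK, hlt⟩ := hA.exists_isCompact_sdiff_lt (μ := ν) (measure_ne_top ν A)
      (ε := μ A - r) (tsub_pos_of_lt hr).ne'
    refine ⟨K, hKA, hK, ?_⟩
    have h1 : μ (A \ K) < μ A - r := (h _).trans_lt hlt
    have h2 : μ A ≤ μ K + μ (A \ K) := by
      rw [← measure_inter_add_sdiff A hK.measurableSet, Set.inter_eq_self_of_subset_right hKA]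
    by_contra! hcon
    have h3 : μ A < r + (μ A - r) :=
      h2.trans_lt (ENNReal.add_lt_add_of_le_of_lt (measure_ne_top _ _) hcon h1)
    rw [add_tsub_cancel_of_le hr.le] at h3
    exact lt_irrefl _ h3
  infer_instance

/-- The space `M(X)` of regular complex Borel measures on a compact Hausdorff space. -/
def RegularMeasure : Submodule ℂ (ComplexMeasure X) where
  carrier := {μ | μ.variation.Regular}
  zero_mem' := by
    simp only [Set.mem_ofPred_eq, VectorMeasure.variation_zero]
    infer_instance
  add_mem' := by
    intro μ ν hμ hν
    simp only [Set.mem_ofPred_eq] at hμ hν ⊢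
    have : (μ.variation + ν.variation).Regular := by
      have : IsFiniteMeasure μ.variation := ⟨isCompact_univ.measure_lt_top⟩
      have : IsFiniteMeasure ν.variation := ⟨isCompact_univ.measure_lt_top⟩
      infer_instance
    exact regular_of_le VectorMeasure.variation_add_le
  smul_mem' := by
    intro c μ hμ
    simp only [Set.mem_ofPred_eq] at hμ ⊢
    rw [VectorMeasure.variation_smul]
    infer_instance

variable {X}

lemma isFiniteMeasure_variation (μ : RegularMeasure X) : IsFiniteMeasure μ.1.variation := by
  have : μ.1.variation.Regular := μ.2
  exact ⟨isCompact_univ.measure_lt_top⟩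

variable (X) in
/-- The total variation norm `|μ|(X)`. -/
def totalVariationNorm : AddGroupNorm (RegularMeasure X) where
  toFun μ := μ.1.variation.real Set.univ
  map_zero' := by simp
  add_le' μ ν := by
    have := isFiniteMeasure_variation μ
    have := isFiniteMeasure_variation ν
    have h := (VectorMeasure.variation_add_le (μ := μ.1) (ν := ν.1)) Set.univ
    rw [Measure.real, Measure.real, Measure.real,
      ← ENNReal.toReal_add (by finiteness) (by finiteness)]
    exact ENNReal.toReal_mono (by finiteness) h
  neg' μ := by simp
  eq_zero_of_map_eq_zero' μ h := by
    have := isFiniteMeasure_variation μ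
    have h0 : μ.1.variation Set.univ = 0 := by
      simpa [Measure.real, ENNReal.toReal_eq_zero_iff] using h
    ext E hE
    have h1 := VectorMeasure.enorm_measure_le_variation μ.1 E
    rw [measure_mono_null (Set.subset_univ E) h0] at h1
    simpa using h1

instance : NormedAddCommGroup (RegularMeasure X) := (totalVariationNorm X).toNormedAddCommGroup

lemma RegularMeasure.norm_def (μ : RegularMeasure X) : ‖μ‖ = μ.1.variation.real Set.univ := rfl

instance : NormedSpace ℂ (RegularMeasure X) where
  norm_smul_le c μ := by
    rw [RegularMeasure.norm_def, RegularMeasure.norm_def]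
    simp [Measure.real, VectorMeasure.variation_smul]

/-- The integral `∫ f dμ` of a complex function against a complex measure. -/
def cintegral (μ : RegularMeasure X) (f : X → ℂ) : ℂ :=
  VectorMeasure.integral μ.1 f (ContinuousLinearMap.mul ℝ ℂ)

/-- `κ = μ * ν` is the convolution of the measures `μ`, `ν` on a compact group, that is, the regular
measure with `∫ f dκ = ∫∫ f(xy) dν(y) dμ(x)` for all continuous `f`. -/
def IsConvolution [Mul X] (μ ν κ : RegularMeasure X) : Prop :=
  ∀ f : C(X, ℂ), cintegral κ f = cintegral μ fun x => cintegral ν fun y => f (x * y)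

end RegularMeasure

/-! ### The dual group and the map `ρ : C(G) → C*_red(S)` -/

section Group

/-- The compact dual group `G` of the discrete group `Γ`. -/
abbrev DualGroup (Γ : Type*) [AddCommGroup Γ] [TopologicalSpace Γ] : Type _ :=
  PontryaginDual (Multiplicative Γ)

variable {Γ : Type*} [AddCommGroup Γ] [TopologicalSpace Γ]

instance : MeasurableSpace (DualGroup Γ) := borel _

instance : BorelSpace (DualGroup Γ) := ⟨rfl⟩

/-- The character `χ^a` of `G` given by evaluation at `a ∈ Γ`. -/
def character (a : Γ) : C(DualGroup Γ, ℂ) where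
  toFun α := (α (Multiplicative.ofAdd a) : ℂ)
  continuous_toFun := continuous_subtype_val.comp
    (ContinuousEvalConst.continuous_eval_const (F := Multiplicative Γ →ₜ* Circle)
      (Multiplicative.ofAdd a))

lemma character_apply (a : Γ) (α : DualGroup Γ) :
    character a α = (α (Multiplicative.ofAdd a) : ℂ) := rfl

lemma character_mul (a b : Γ) : character a * character b = character (a + b) := by
  ext α
  simp [character_apply, ofAdd_add]

lemma star_character (a : Γ) : star (character a) = character (-a) := by
  ext α
  simp [character_apply, ofAdd_neg, ← Circle.coe_inv_eq_conj]

lemma character_zero : character (0 : Γ) = 1 := by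
  ext α
  simp [character_apply]

variable [DiscreteTopology Γ]

variable (Γ) in
/-- The normalized Haar measure of `G`. -/
def haar : Measure (DualGroup Γ) := Measure.haarMeasure ⊤

instance : IsProbabilityMeasure (haar Γ) := ⟨by
  have := Measure.haarMeasure_self (G := DualGroup Γ) (K₀ := ⊤)
  simpa [haar] using this⟩

instance : (haar Γ).IsHaarMeasure := by unfold haar; infer_instance

lemma exists_character_ne_one {a : Γ} (ha : a ≠ 0) : ∃ α : DualGroup Γ, character a α ≠ 1 := by
  obtain ⟨c, hc⟩ := CharacterModule.exists_character_apply_ne_zero_of_ne_zero ha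
  let i : AddCircle (1 : ℚ) →+ AddCircle (1 : ℝ) :=
    QuotientAddGroup.map _ _ (Rat.castHom ℝ).toAddMonoidHom (by
      rw [AddSubgroup.zmultiples_le]
      exact AddSubgroup.mem_comap.2 (by simp))
  have hi : ∀ z, i z = 0 → z = 0 := by
    intro z
    induction z using QuotientAddGroup.induction_on with
    | H q =>
      intro hz
      have hz' : ((q : ℝ) : AddCircle (1 : ℝ)) = 0 := hz
      rw [AddCircle.coe_eq_zero_iff] at hz'
      obtain ⟨n, hn⟩ := hz'
      refine (AddCircle.coe_eq_zero_iff (p := (1 : ℚ))).2 ⟨n, ?_⟩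
      have : ((n : ℚ) : ℝ) = (q : ℝ) := by simpa using hn
      simpa using Rat.cast_injective this
  let α : Multiplicative Γ →ₜ* Circle :=
    { toFun := fun g => AddCircle.toCircle (i (c g.toAdd))
      map_one' := by simp
      map_mul' := fun g h => by simp [AddCircle.toCircle_add]
      continuous_toFun := continuous_of_discreteTopology }
  refine ⟨α, fun h => hc (hi _ ?_)⟩
  apply AddCircle.injective_toCircle (one_ne_zero (α := ℝ))
  rw [AddCircle.toCircle_zero]
  exact Circle.ext h

lemma integral_character {a : Γ} (ha : a ≠ 0) : ∫ α, character a α ∂haar Γ = 0 := by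
  obtain ⟨β, hβ⟩ := exists_character_ne_one ha
  have h := integral_mul_left_eq_self (μ := haar Γ) (fun α => character a α) β
  have h2 : ∀ α, character a (β * α) = character a β * character a α := fun α => by
    simp only [character_apply]
    rw [← Circle.coe_mul]; rfl
  simp_rw [h2, integral_const_mul] at h
  have h3 : (character a β - 1) * ∫ α, character a α ∂haar Γ = 0 := by rw [sub_mul, h]; ring
  exact (mul_eq_zero.1 h3).resolve_left (sub_ne_zero.2 hβ)

lemma orthonormal_character :
    Orthonormal ℂ (fun a : Γ => ContinuousMap.toLp 2 (haar Γ) ℂ (character a)) := by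
  classical
  rw [orthonormal_iff_ite]
  intro a b
  rw [ContinuousMap.inner_toLp]
  have : ∀ α, character b α * (starRingEnd ℂ) (character a α) = character (b - a) α := by
    intro α
    rw [sub_eq_add_neg, ← character_mul, ← star_character]; rfl
  simp_rw [this]
  by_cases h : a = b
  · subst h; simp [character_zero]
  · rw [integral_character (sub_ne_zero.2 (Ne.symm h))]; simp [h]

lemma span_character_dense :
    (Submodule.span ℂ (Set.range (character (Γ := Γ)))).topologicalClosure = ⊤ := by
  let A : StarSubalgebra ℂ C(DualGroup Γ, ℂ) :=
    { toSubalgebra := Algebra.adjoin ℂ (Set.range character)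
      star_mem' := by
        change Algebra.adjoin ℂ (Set.range (character (Γ := Γ))) ≤
          star (Algebra.adjoin ℂ (Set.range character))
        refine Algebra.adjoin_le ?_
        rintro - ⟨n, rfl⟩
        exact Algebra.subset_adjoin ⟨-n, (star_character n).symm⟩ }
  have hA : A.SeparatesPoints := by
    intro x y hxy
    by_contra! h
    apply hxy
    ext a
    exact h _ ⟨character a.toAdd, Algebra.subset_adjoin ⟨_, rfl⟩, rfl⟩
  have h1 := ContinuousMap.starSubalgebra_topologicalClosure_eq_top_of_separatesPoints A hA
  have h2 : (Submodule.span ℂ (Set.range (character (Γ := Γ)))) =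
      Subalgebra.toSubmodule A.toSubalgebra := by
    refine (Algebra.adjoin_eq_span_of_subset _ ?_).symm
    refine Set.Subset.trans ?_ Submodule.subset_span
    intro x hx
    refine Submonoid.closure_induction (fun _ => id) ⟨0, character_zero⟩ ?_ hx
    rintro _ _ _ _ ⟨m, rfl⟩ ⟨n, rfl⟩
    exact ⟨m + n, (character_mul m n).symm⟩
  rw [h2]
  exact congrArg (fun B => Subalgebra.toSubmodule B.toSubalgebra) h1

variable (S : AddSubmonoid Γ)

lemma orthonormal_character_sub : Orthonormal ℂ
    (fun a : S => ContinuousMap.toLp 2 (haar Γ) ℂ (character (a : Γ))) :=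
  orthonormal_character.comp _ Subtype.val_injective

/-- The inverse Fourier transform `ℓ²(S) → L²(G)`, `e_a ↦ χ^a`: an isometry onto the space `H²(S)`
of functions with spectrum in `S`. -/
def fourierEmb : EllTwo S →L[ℂ] Lp ℂ 2 (haar Γ) :=
  (orthonormal_character_sub S).orthogonalFamily.linearIsometry.toContinuousLinearMap

lemma fourierEmb_basisVec (a : S) :
    fourierEmb S (basisVec S a) = ContinuousMap.toLp 2 (haar Γ) ℂ (character (a : Γ)) := by
  classical
  simp [fourierEmb, basisVec]

variable (Γ) in
/-- The multiplication operators `T_f g = f g` on `L²(G)`, `f ∈ C(G)`. -/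
def mulOp : C(DualGroup Γ, ℂ) →L[ℂ] (Lp ℂ 2 (haar Γ) →L[ℂ] Lp ℂ 2 (haar Γ)) :=
  ((ContinuousLinearMap.mul ℂ ℂ).holderL (haar Γ) ∞ 2 2) ∘L (ContinuousMap.toLp ∞ (haar Γ) ℂ)

lemma mulOp_toLp (f g : C(DualGroup Γ, ℂ)) :
    mulOp Γ f (ContinuousMap.toLp 2 (haar Γ) ℂ g) =
      ContinuousMap.toLp 2 (haar Γ) ℂ (f * g) := by
  refine Lp.ext ?_
  refine (ContinuousLinearMap.coeFn_holder _ _ _).trans ?_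
  filter_upwards [ContinuousMap.coeFn_toLp (p := ∞) (𝕜 := ℂ) (haar Γ) f,
    ContinuousMap.coeFn_toLp (p := 2) (𝕜 := ℂ) (haar Γ) g,
    ContinuousMap.coeFn_toLp (p := 2) (𝕜 := ℂ) (haar Γ) (f * g)] with x h1 h2 h3
  have h1' : (((ContinuousMap.toLp ∞ (haar Γ) ℂ).toLinearMap f :
    Lp ℂ ∞ (haar Γ)) : DualGroup Γ → ℂ) x = f x := h1
  rw [h2, h3]
  refine (congrArg (fun z => z * g x) h1').trans rfl

/-- The operator on `ℓ²(S)` with symbol `f`: the compression `P_S T_f P_S` of the multiplication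
operator to `H²(S)`, carried over to `ℓ²(S)` by the Fourier transform. -/
def toeplitz : C(DualGroup Γ, ℂ) →L[ℂ] (EllTwo S →L[ℂ] EllTwo S) :=
  (ContinuousLinearMap.compL ℂ (EllTwo S) (Lp ℂ 2 (haar Γ)) (EllTwo S) (fourierEmb S).adjoint) ∘L
    ((ContinuousLinearMap.compL ℂ (EllTwo S) (Lp ℂ 2 (haar Γ))
      (Lp ℂ 2 (haar Γ))).flip (fourierEmb S)) ∘L mulOp Γ

lemma toeplitz_apply (f : C(DualGroup Γ, ℂ)) :
    toeplitz S f = (fourierEmb S).adjoint ∘L mulOp Γ f ∘L fourierEmb S := rfl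

lemma toeplitz_character (a b : S) :
    toeplitz S (character ((b : Γ) - a)) = star (shiftOp S a) * shiftOp S b := by
  classical
  refine ext_basisVec S fun x y => ?_
  have h1 := orthonormal_iff_ite.1 (orthonormal_character (Γ := Γ)) (x : Γ) ((b : Γ) - a + y)
  have h2 := orthonormal_iff_ite.1 (orthonormal_basisVec S) (a + x) (b + y)
  rw [toeplitz_apply, ContinuousLinearMap.comp_apply, ContinuousLinearMap.comp_apply,
    ContinuousLinearMap.adjoint_inner_right, fourierEmb_basisVec, fourierEmb_basisVec, mulOp_toLp,
    character_mul, h1, ContinuousLinearMap.mul_def, ContinuousLinearMap.comp_apply,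
    ContinuousLinearMap.star_eq_adjoint,
    ContinuousLinearMap.adjoint_inner_right, shiftOp_basisVec, shiftOp_basisVec, h2]
  refine if_congr ?_ rfl rfl
  rw [Subtype.ext_iff]
  simp only [AddSubmonoid.coe_add]
  constructor
  · intro h; rw [h]; abel
  · intro h; rw [eq_comm, sub_add_eq_add_sub, ← h]; abel

variable {S}

lemma toeplitz_mem (hS : ∀ c : Γ, ∃ a ∈ S, ∃ b ∈ S, c = a - b) (f : C(DualGroup Γ, ℂ)) :
    toeplitz S f ∈ Cred S := by
  have hcl : IsClosed (Cred S : Set (EllTwo S →L[ℂ] EllTwo S)) :=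
    StarSubalgebra.isClosed_topologicalClosure _
  have hsub : (Submodule.span ℂ (Set.range (character (Γ := Γ)))) ≤
      (Subalgebra.toSubmodule (Cred S).toSubalgebra).comap (toeplitz S).toLinearMap := by
    rw [Submodule.span_le]
    rintro _ ⟨c, rfl⟩
    obtain ⟨b, hb, a, ha, rfl⟩ := hS c
    have := toeplitz_character S ⟨a, ha⟩ ⟨b, hb⟩
    change toeplitz S (character (b - a)) ∈ Cred S
    rw [this]
    exact mul_mem (star_mem (shiftOp_mem S _)) (shiftOp_mem S _)
  have := Submodule.topologicalClosure_minimal _ hsub (hcl.preimage (toeplitz S).continuous)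
  rw [span_character_dense] at this
  exact this (Submodule.mem_top (x := f))

/-- The map `ρ : C(G) → C*_red(S)`, sending `f` to the operator with symbol `f`, for a semigroup
`S` that generates `Γ`. -/
def rho (hS : ∀ c : Γ, ∃ a ∈ S, ∃ b ∈ S, c = a - b) : C(DualGroup Γ, ℂ) →L[ℂ] Cred S :=
  (toeplitz S).codRestrict (Subalgebra.toSubmodule (Cred S).toSubalgebra) (toeplitz_mem hS)

end Group

end SemigroupCstar

end

open SemigroupCstar

/-!
# The dual of the reduced semigroup C*-algebra and the measure algebra

Every monomial `V` has an index `c ∈ Γ`: it maps `e_x` to `e_{c + x}` for all `x` in some translate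
`s + S`. So far out in the semigroup `V` acts as multiplication by the character `χ^c`, and a
combination `A` of monomials acts there as multiplication by a trigonometric polynomial `f`.
Multiplication by a character `χ^t`, `t ∈ S`, is unitary, commutes with multiplication by `f`, and
carries any given trigonometric polynomial into that region. Hence `‖f‖ ≤ ‖A‖`
(`norm_le_of_mem_symbolGraph`), and `A ↦ f` extends to a contractive homomorphism `σ` from the
algebra onto `C(G)`, the symbol map (`symbolMap`). As `C(G)` is commutative, `σ` vanishes on the
commutator ideal `K` (`symbolMap_eq_zero`), and `σ ∘ ρ = id` (`symbolMap_rho`).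

Modulo `K` every monomial is one of the `T_a^* T_b = ρ(χ^{b - a})` (`exists_sub_genDiff_mem`), so a
functional `ξ ∈ K^⊥` satisfies `ξ = ξ ∘ ρ ∘ σ` (`apply_rho_symbolMap`). Since `ρ` and `σ` are
contractions, `ξ ↦ ξ ∘ ρ` is an isometric isomorphism of `K^⊥` with the dual of `C(G)`, with inverse
`Λ ↦ Λ ∘ σ` (`annihilatorEquiv`). The dual of `C(G)` is `M(G)` by the Riesz representation theorem
for complex functionals (`rieszEquiv`), which follows from the one for positive functionals by the
Jordan decomposition, and from approximation in `L¹` for the norm.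

The product and the projection are controlled by the Fourier coefficients `c ↦ ξ(ρ(χ^c))`. They
determine the elements of `K^⊥`, as trigonometric polynomials are dense in `C(G)`; convolution
multiplies them; and so does the product of the dual, since each `ρ(χ^c)` is a monomial. The
projection `π ξ = ξ ∘ ρ ∘ σ` preserves them, and its kernel consists of the functionals whose
Fourier coefficients vanish, which is `ρ(C(G))^⊥`.
-/

namespace SemigroupCstar

/-! ### Integration of continuous functions against complex measures -/

section RegularMeasure

lemma transpose_apply {X E F G : Type*} [MeasurableSpace X] [NormedAddCommGroup E] [NormedSpace ℝ E]
    [NormedAddCommGroup F] [NormedSpace ℝ F] [NormedAddCommGroup G] [NormedSpace ℝ G]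
    (μ : VectorMeasure X F) (B : E →L[ℝ] F →L[ℝ] G) (s : Set X) (x : E) :
    μ.transpose B s x = B x (μ s) := rfl

lemma variation_toComplexMeasure_le {X : Type*} [MeasurableSpace X] (m : Measure X)
    [IsFiniteMeasure m] :
    (m.toSignedMeasure.toComplexMeasure 0).variation ≤ m := by
  refine VectorMeasure.variation_le_of_forall_enorm_le fun s hs => ?_
  rw [SignedMeasure.toComplexMeasure_apply, Measure.toSignedMeasure_apply_measurable hs]
  change ‖((m.real s : ℝ) : ℂ)‖ₑ ≤ _
  rw [← ofReal_norm, Complex.norm_real, Real.norm_of_nonneg measureReal_nonneg,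
    Measure.real, ENNReal.ofReal_toReal (by finiteness)]

variable {X : Type*} [TopologicalSpace X] [CompactSpace X] [T2Space X] [MeasurableSpace X]
  [BorelSpace X]

lemma integrable_variation (μ : RegularMeasure X) (f : C(X, ℂ)) :
    Integrable f μ.1.variation := by
  have := isFiniteMeasure_variation μ
  exact f.continuous.integrable_of_hasCompactSupport (HasCompactSupport.of_compactSpace f)

lemma cintegral_add (μ : RegularMeasure X) (f g : C(X, ℂ)) :
    cintegral μ (f + g) = cintegral μ f + cintegral μ g :=
  VectorMeasure.integral_add (integrable_variation μ f) (integrable_variation μ g)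

lemma cintegral_smul (μ : RegularMeasure X) (c : ℂ) (f : X → ℂ) :
    cintegral μ (c • f) = c * cintegral μ f := by
  refine setToFun_smul _ (fun c s x => ?_) c f
  simp [transpose_apply, mul_assoc]

lemma cintegral_add_measure (μ ν : RegularMeasure X) (f : C(X, ℂ)) :
    cintegral (μ + ν) f = cintegral μ f + cintegral ν f :=
  VectorMeasure.integral_add_vectorMeasure (integrable_variation μ f) (integrable_variation ν f)

lemma cintegral_smul_measure (c : ℂ) (μ : RegularMeasure X) (f : C(X, ℂ)) :
    cintegral (c • μ) f = c * cintegral μ f := by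
  have h := VectorMeasure.continuousLinearMap_apply_integral
    (B := ContinuousLinearMap.mul ℝ ℂ) (C := ContinuousLinearMap.mul ℝ ℂ c)
    (integrable_variation μ f)
  refine Eq.trans ?_ h.symm
  -- Both sides are integrals of `f` against operator-valued measures, of `c • μ` and of `c * μ`,
  -- which agree.
  have hT : (c • μ).1.transpose (ContinuousLinearMap.mul ℝ ℂ) =
      μ.1.transpose ((ContinuousLinearMap.compL ℝ ℂ ℂ ℂ (ContinuousLinearMap.mul ℝ ℂ c)) ∘L
        ContinuousLinearMap.mul ℝ ℂ) := by
    refine VectorMeasure.ext fun s hs => ContinuousLinearMap.ext fun x => ?_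
    simp [transpose_apply, mul_left_comm]
  have hd := VectorMeasure.integral_eq_setToFun (μ := μ.1) (f := f)
    (B := (ContinuousLinearMap.compL ℝ ℂ ℂ ℂ (ContinuousLinearMap.mul ℝ ℂ c)) ∘L
        ContinuousLinearMap.mul ℝ ℂ)
  rw [hd]
  symm
  rw [cintegral, VectorMeasure.integral_eq_setToFun]
  have hd2 := dominatedFinMeasAdditive_cbmApplyMeasure (c • μ).1 (ContinuousLinearMap.mul ℝ ℂ)
  rw [hT] at hd2
  rw [setToFun_congr_measure_of_integrable ‖c‖ₑ (by simp) _ _ hd2 f (integrable_variation μ f)]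
  · exact setToFun_congr_left _ _ (by rw [hT]) _
  · rw [SetLike.val_smul, VectorMeasure.variation_smul]
    intro s
    simp [enorm_eq_nnnorm]

lemma norm_cintegral_sub_le (μ : RegularMeasure X) {f g : X → ℂ}
    (hf : Integrable f μ.1.variation) (hg : Integrable g μ.1.variation) :
    ‖cintegral μ f - cintegral μ g‖ ≤ ∫ x, ‖f x - g x‖ ∂μ.1.variation := by
  rw [cintegral, cintegral, ← VectorMeasure.integral_sub hf hg]
  refine VectorMeasure.norm_integral_le_integral_norm.trans ?_
  simp

lemma norm_cintegral_le (μ : RegularMeasure X) (f : C(X, ℂ)) :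
    ‖cintegral μ f‖ ≤ ‖μ‖ * ‖f‖ := by
  have := isFiniteMeasure_variation μ
  refine (VectorMeasure.norm_integral_le_of_norm_le_const
    (.of_forall f.norm_coe_le_norm)).trans ?_
  simp [RegularMeasure.norm_def, mul_comm]

variable (X) in
/-- Integration of continuous functions against regular complex measures, as a map from the
measures to the dual of `C(X)`. -/
noncomputable def integralCLM : RegularMeasure X →ₗ[ℂ] StrongDual ℂ C(X, ℂ) where
  toFun μ := LinearMap.mkContinuous
    { toFun := fun f => cintegral μ f
      map_add' := cintegral_add μ
      map_smul' := fun c f => cintegral_smul μ c f } ‖μ‖ (norm_cintegral_le μ)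
  map_add' μ ν := by
    ext f
    exact cintegral_add_measure μ ν f
  map_smul' c μ := by
    ext f
    exact cintegral_smul_measure c μ f

lemma integralCLM_apply (μ : RegularMeasure X) (f : C(X, ℂ)) :
    integralCLM X μ f = cintegral μ f := rfl

lemma norm_integralCLM_le (μ : RegularMeasure X) : ‖integralCLM X μ‖ ≤ ‖μ‖ :=
  ContinuousLinearMap.opNorm_le_bound _ (norm_nonneg _) (norm_cintegral_le μ)

/-- Radial truncation to the unit disc moves a value `z` at most as far as its distance from any
point `w` of the disc. -/
lemma norm_truncation_sub_le {z w : ℂ} (hw : ‖w‖ ≤ 1) :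
    ‖w - (((max 1 ‖z‖)⁻¹ : ℝ) : ℂ) * z‖ ≤ 2 * ‖w - z‖ := by
  have h1 : ‖z - (((max 1 ‖z‖)⁻¹ : ℝ) : ℂ) * z‖ ≤ ‖w - z‖ := by
    rcases le_total ‖z‖ 1 with h | h
    · simp [max_eq_left h]
    · have h0 : 0 < ‖z‖ := by linarith
      have h2 : z - (((max 1 ‖z‖)⁻¹ : ℝ) : ℂ) * z = ((1 - ‖z‖⁻¹ : ℝ) : ℂ) * z := by
        rw [max_eq_right h]; push_cast; ring
      have h3 : 0 ≤ 1 - ‖z‖⁻¹ := by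
        rw [sub_nonneg]; exact inv_le_one_of_one_le₀ h
      rw [h2, norm_mul, Complex.norm_real, Real.norm_of_nonneg h3, sub_mul,
        inv_mul_cancel₀ h0.ne']
      have := norm_sub_norm_le z w
      rw [norm_sub_rev] at this
      linarith
  calc _ = ‖(w - z) + (z - (((max 1 ‖z‖)⁻¹ : ℝ) : ℂ) * z)‖ := by congr 1; ring
    _ ≤ _ := (norm_add_le _ _).trans (by linarith)

/-- A measurable function with values in the unit disc is approximated in `L¹` by continuous
functions with values in the unit disc. -/
lemma exists_continuous_norm_le_one {m : Measure X} [m.Regular] [IsFiniteMeasure m] {s : X → ℂ}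
    (hs : Integrable s m) (hs1 : ∀ x, ‖s x‖ ≤ 1) {ε : ℝ} (hε : 0 < ε) :
    ∃ g : C(X, ℂ), ‖g‖ ≤ 1 ∧ ∫ x, ‖s x - g x‖ ∂m ≤ ε := by
  obtain ⟨g, -, hg, hgc, hgi⟩ := hs.exists_hasCompactSupport_integral_sub_le (half_pos hε)
  let h : C(X, ℂ) :=
    { toFun := fun x => (((max 1 ‖g x‖)⁻¹ : ℝ) : ℂ) * g x
      continuous_toFun := by
        refine (Complex.continuous_ofReal.comp (Continuous.inv₀ (by fun_prop) fun x => ?_)).mul hgc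
        exact (lt_of_lt_of_le one_pos (le_max_left _ _)).ne' }
  refine ⟨h, (ContinuousMap.norm_le _ zero_le_one).2 fun x => ?_, ?_⟩
  · have h0 : 0 < max 1 ‖g x‖ := lt_of_lt_of_le one_pos (le_max_left _ _)
    change ‖(((max 1 ‖g x‖)⁻¹ : ℝ) : ℂ) * g x‖ ≤ 1
    rw [norm_mul, Complex.norm_real, Real.norm_of_nonneg (inv_nonneg.2 h0.le)]
    rw [inv_mul_le_iff₀ h0, mul_one]
    exact le_max_right _ _
  · calc ∫ x, ‖s x - h x‖ ∂m ≤ ∫ x, 2 * ‖s x - g x‖ ∂m :=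
          integral_mono_of_nonneg (.of_forall fun x => norm_nonneg _)
            ((hs.sub hgi).norm.const_mul 2) (.of_forall fun x => norm_truncation_sub_le (hs1 x))
      _ ≤ ε := by rw [integral_const_mul]; linarith

open ComplexConjugate in
/-- The total variation norm is at most the dual norm: test against continuous approximations of
the conjugate phase of the measure along a fine partition. -/
lemma le_norm_integralCLM (μ : RegularMeasure X) : ‖μ‖ ≤ ‖integralCLM X μ‖ := by
  classical
  have := isFiniteMeasure_variation μ
  have : μ.1.variation.Regular := μ.2
  refine le_of_forall_pos_le_add fun ε hε => ?_
  obtain ⟨P, -, hPd, hPm, hP⟩ := VectorMeasure.exists_variation_le_add μ.1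
    (s := Set.univ) MeasurableSet.univ (ε := (ε / 2).toNNReal) (by simpa using hε)
    (measure_ne_top _ _)
  -- The integral of the step function with value the conjugate phase of `μ E` on each `E` in the
  -- partition is `∑ ‖μ E‖`.
  let c : Set X → ℂ := fun E => conj (μ.1 E) / ‖μ.1 E‖
  have hc : ∀ E, ‖c E‖ ≤ 1 := fun E => by
    simp only [c, norm_div, RCLike.norm_conj, Complex.norm_real, norm_norm]
    exact div_self_le_one _
  have hcμ : ∀ E, c E * μ.1 E = (‖μ.1 E‖ : ℂ) := fun E => by
    simp only [c]
    by_cases h : μ.1 E = 0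
    · simp [h]
    · have : (‖μ.1 E‖ : ℂ) ≠ 0 := by simpa using h
      rw [div_mul_eq_mul_div, div_eq_iff this, mul_comm, Complex.mul_conj, Complex.normSq_eq_norm_sq]
      push_cast; ring
  let s : X → ℂ := fun x => ∑ E ∈ P, E.indicator (fun _ => c E) x
  have hi : ∀ E ∈ P, Integrable (E.indicator fun _ => c E) μ.1.variation := fun E hE =>
    (integrable_const (c E)).indicator (hPm E hE)
  have hs : Integrable s μ.1.variation := integrable_finsetSum _ hi
  have hs1 : ∀ x, ‖s x‖ ≤ 1 := by
    intro x
    by_cases hx : ∃ E ∈ P, x ∈ E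
    · obtain ⟨E, hE, hxE⟩ := hx
      have : s x = c E := by
        simp only [s]
        rw [Finset.sum_eq_single_of_mem E hE, Set.indicator_of_mem hxE]
        intro F hF hFE
        exact Set.indicator_of_notMem
          (fun hxF => Set.disjoint_left.1 (hPd hF hE hFE) hxF hxE) _
      rw [this]; exact hc E
    · push Not at hx
      have : s x = 0 := Finset.sum_eq_zero fun E hE => Set.indicator_of_notMem (hx E hE) _
      simp [this]
  have hint : cintegral μ s = ((∑ E ∈ P, ‖μ.1 E‖ : ℝ) : ℂ) := by
    rw [cintegral, VectorMeasure.integral_finsetSum _ hi]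
    push_cast
    refine Finset.sum_congr rfl fun E hE => ?_
    rw [VectorMeasure.integral_indicator_const _ (hPm E hE), ← hcμ E]
    rfl
  obtain ⟨g, hg1, hg⟩ := exists_continuous_norm_le_one hs hs1 (half_pos hε)
  have h1 : ‖μ‖ ≤ ∑ E ∈ P, ‖μ.1 E‖ + ε / 2 := by
    rw [RegularMeasure.norm_def, Measure.real]
    have hfin : ∀ E ∈ P, ‖μ.1 E‖ₑ ≠ ∞ := fun E _ => enorm_ne_top
    have hfin' := ENNReal.sum_ne_top.2 hfin
    refine (ENNReal.toReal_mono (by finiteness) hP).trans ?_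
    rw [ENNReal.toReal_add hfin' (by finiteness), ENNReal.toReal_sum hfin]
    simp [(half_pos hε).le]
  have h2 : ‖cintegral μ s‖ = ∑ E ∈ P, ‖μ.1 E‖ := by
    rw [hint, Complex.norm_real, Real.norm_of_nonneg (by positivity)]
  have h3 := (norm_cintegral_sub_le μ hs (integrable_variation μ g)).trans hg
  have h4 : ‖cintegral μ g‖ ≤ ‖integralCLM X μ‖ :=
    (integralCLM X μ).unit_le_opNorm g hg1
  have h5 := norm_sub_norm_le (cintegral μ s) (cintegral μ g)
  linarith

/-- A finite regular positive measure, regarded as a regular complex measure. -/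
noncomputable def RegularMeasure.ofMeasure (m : Measure X) [IsFiniteMeasure m] [m.Regular] :
    RegularMeasure X :=
  ⟨m.toSignedMeasure.toComplexMeasure 0, regular_of_le (variation_toComplexMeasure_le m)⟩

lemma cintegral_ofMeasure (m : Measure X) [IsFiniteMeasure m] [m.Regular] (f : C(X, ℂ)) :
    cintegral (RegularMeasure.ofMeasure m) f = ∫ x, f x ∂m := by
  have hf : Integrable f m :=
    f.continuous.integrable_of_hasCompactSupport (HasCompactSupport.of_compactSpace f)
  have hT : ∀ s, MeasurableSet s →
      (RegularMeasure.ofMeasure m).1.transpose (ContinuousLinearMap.mul ℝ ℂ) s =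
        (weightedSMul m s : ℂ →L[ℝ] ℂ) := by
    intro s hs
    refine ContinuousLinearMap.ext fun x => ?_
    have h : (RegularMeasure.ofMeasure m).1 s = ((m.real s : ℝ) : ℂ) := by
      change (⟨m.toSignedMeasure s, _⟩ : ℂ) = _
      rw [Measure.toSignedMeasure_apply_measurable hs]
      rfl
    rw [transpose_apply, h, weightedSMul_apply, Complex.real_smul, mul_comm]
    rfl
  rw [cintegral, VectorMeasure.integral_eq_setToFun, integral_eq_setToFun]
  have hd := dominatedFinMeasAdditive_cbmApplyMeasure (RegularMeasure.ofMeasure m).1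
    (ContinuousLinearMap.mul ℝ ℂ)
  have hle : (RegularMeasure.ofMeasure m).1.variation ≤ m := variation_toComplexMeasure_le m
  rw [← setToFun_congr_measure_of_integrable (μ := m) 1 (by simp) (by simpa using hle)
    (hd.of_measure_le hle (by positivity)) hd f hf]
  exact setToFun_congr_left' _ _ (fun s hs _ => hT s hs) _

end RegularMeasure

/-! ### The Riesz representation theorem for complex functionals -/

section Riesz

open scoped NNReal CompactlySupported

variable {X : Type*} [TopologicalSpace X]

/-- The positive part of a real functional on `C(X)`, at a nonnegative function: the supremum of
the values on the order interval `[0, f]`. -/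
noncomputable def functionalPosPart (φ : C(X, ℝ) →L[ℝ] ℝ) (f : C(X, ℝ)) : ℝ :=
  sSup (φ '' Set.Icc 0 f)

variable (φ : C(X, ℝ) →L[ℝ] ℝ)

lemma functionalPosPart_le {f : C(X, ℝ)} (hf : 0 ≤ f) {a : ℝ}
    (ha : ∀ h, 0 ≤ h → h ≤ f → φ h ≤ a) : functionalPosPart φ f ≤ a := by
  refine csSup_le ⟨φ 0, 0, ⟨le_rfl, hf⟩, rfl⟩ ?_
  rintro _ ⟨h, ⟨h0, h1⟩, rfl⟩
  exact ha h h0 h1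

variable [CompactSpace X]

lemma bddAbove_image_Icc (f : C(X, ℝ)) : BddAbove (φ '' Set.Icc 0 f) := by
  refine ⟨‖φ‖ * ‖f‖, ?_⟩
  rintro _ ⟨h, ⟨h0, h1⟩, rfl⟩
  refine (le_abs_self _).trans ((φ.le_opNorm h).trans ?_)
  gcongr
  refine (ContinuousMap.norm_le _ (norm_nonneg _)).2 fun x => ?_
  have hx : 0 ≤ h x := h0 x
  rw [Real.norm_of_nonneg hx]
  exact (h1 x).trans ((le_abs_self _).trans (f.norm_coe_le_norm x))

lemma le_functionalPosPart {f h : C(X, ℝ)} (h0 : 0 ≤ h) (hf : h ≤ f) :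
    φ h ≤ functionalPosPart φ f :=
  le_csSup (bddAbove_image_Icc φ f) ⟨h, ⟨h0, hf⟩, rfl⟩

lemma functionalPosPart_nonneg {f : C(X, ℝ)} (hf : 0 ≤ f) : 0 ≤ functionalPosPart φ f := by
  simpa using le_functionalPosPart φ le_rfl hf

lemma functionalPosPart_add {f g : C(X, ℝ)} (hf : 0 ≤ f) (hg : 0 ≤ g) :
    functionalPosPart φ (f + g) = functionalPosPart φ f + functionalPosPart φ g := by
  apply le_antisymm
  · refine functionalPosPart_le φ (add_nonneg hf hg) fun h h0 h1 => ?_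
    have h2 := le_functionalPosPart φ (le_inf h0 hf) (inf_le_right : h ⊓ f ≤ f)
    have h3 : φ (h - h ⊓ f) ≤ functionalPosPart φ g :=
      le_functionalPosPart φ (sub_nonneg.2 inf_le_left) fun x => by
        have h4 : h x ≤ f x + g x := h1 x
        have h5 : 0 ≤ g x := hg x
        change h x - h x ⊓ f x ≤ g x
        rcases le_total (h x) (f x) with h6 | h6
        · rwa [inf_eq_left.2 h6, sub_self]
        · rw [inf_eq_right.2 h6]; linarith
    rw [map_sub] at h3
    linarith
  · rw [← le_sub_iff_add_le]
    refine functionalPosPart_le φ hf fun h h0 h1 => ?_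
    rw [le_sub_comm]
    refine functionalPosPart_le φ hg fun k k0 k1 => ?_
    rw [le_sub_iff_add_le, add_comm, ← map_add]
    exact le_functionalPosPart φ (add_nonneg h0 k0) (add_le_add h1 k1)

lemma functionalPosPart_smul {c : ℝ} {f : C(X, ℝ)} (hc : 0 ≤ c) (hf : 0 ≤ f) :
    functionalPosPart φ (c • f) = c * functionalPosPart φ f := by
  have key : ∀ (c : ℝ) (f : C(X, ℝ)), 0 < c → 0 ≤ f →
      c * functionalPosPart φ f ≤ functionalPosPart φ (c • f) := by
    intro c f hc hf
    rw [← le_div_iff₀' hc]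
    refine functionalPosPart_le φ hf fun h h0 h1 => ?_
    rw [le_div_iff₀' hc, ← smul_eq_mul, ← map_smul]
    exact le_functionalPosPart φ (smul_nonneg hc.le h0) (smul_le_smul_of_nonneg_left h1 hc.le)
  rcases hc.eq_or_lt with rfl | hc
  · rw [zero_smul, zero_mul]
    refine le_antisymm (functionalPosPart_le φ le_rfl fun h h0 h1 => ?_)
      (functionalPosPart_nonneg φ le_rfl)
    rw [le_antisymm h1 h0, map_zero]
  · refine le_antisymm ?_ (key c f hc hf)
    have := key c⁻¹ (c • f) (inv_pos.2 hc) (smul_nonneg hc.le hf)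
    rwa [smul_smul, inv_mul_cancel₀ hc.ne', one_smul, inv_mul_le_iff₀ hc] at this

variable [T2Space X] [MeasurableSpace X] [BorelSpace X]

/-- The Riesz–Markov–Kakutani theorem for a functional given only on the cone of nonnegative
functions. -/
lemma exists_measure_of_additive_on_cone (P : C(X, ℝ) → ℝ) (hP : ∀ f, 0 ≤ f → 0 ≤ P f)
    (hadd : ∀ f g, 0 ≤ f → 0 ≤ g → P (f + g) = P f + P g)
    (hsmul : ∀ (c : ℝ) f, 0 ≤ c → 0 ≤ f → P (c • f) = c * P f) :
    ∃ m : Measure X, m.Regular ∧ ∀ f : C(X, ℝ), 0 ≤ f → ∫ x, f x ∂m = P f := by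
  let r : C_c(X, ℝ≥0) → C(X, ℝ) := fun f => ⟨fun x => f x, by fun_prop⟩
  have hr : ∀ f, 0 ≤ r f := fun f x => (f x).2
  let L : C_c(X, ℝ≥0) →ₗ[ℝ≥0] ℝ≥0 :=
    { toFun := fun f => ⟨P (r f), hP _ (hr f)⟩
      map_add' := fun f g => by
        ext
        have : r (f + g) = r f + r g := by ext; simp [r]
        change P (r (f + g)) = P (r f) + P (r g)
        rw [this, hadd _ _ (hr f) (hr g)]
      map_smul' := fun c f => by
        ext
        have : r (c • f) = (c : ℝ) • r f := by ext; simp [r]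
        change P (r (c • f)) = c * P (r f)
        rw [this, hsmul _ _ c.coe_nonneg (hr f)] }
  refine ⟨NNRealRMK.rieszMeasure L, inferInstance, fun f hf => ?_⟩
  let g : C_c(X, ℝ≥0) := CompactlySupportedContinuousMap.continuousMapEquiv
    ⟨fun x => (f x).toNNReal, by fun_prop⟩
  have hg : ∀ x, (g x : ℝ) = f x := fun x => Real.coe_toNNReal _ (hf x)
  have hrg : r g = f := by ext x; exact hg x
  have h := NNRealRMK.integral_rieszMeasure L g
  simp_rw [hg] at h
  rw [h]
  change P (r g) = _
  rw [hrg]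

/-- Jordan decomposition: a bounded real functional on `C(X)` is a difference of two positive
measures. -/
lemma exists_measure_sub_measure : ∃ m n : Measure X, m.Regular ∧ n.Regular ∧
    ∀ f : C(X, ℝ), φ f = ∫ x, f x ∂m - ∫ x, f x ∂n := by
  obtain ⟨m, hm, hmf⟩ := exists_measure_of_additive_on_cone (functionalPosPart φ)
    (fun f hf => functionalPosPart_nonneg φ hf) (fun f g hf hg => functionalPosPart_add φ hf hg)
    (fun c f hc hf => functionalPosPart_smul φ hc hf)
  obtain ⟨n, hn, hnf⟩ := exists_measure_of_additive_on_cone (fun f => functionalPosPart φ f - φ f)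
    (fun f hf => sub_nonneg.2 (le_functionalPosPart φ hf le_rfl))
    (fun f g hf hg => by rw [functionalPosPart_add φ hf hg, map_add]; ring)
    (fun c f hc hf => by rw [functionalPosPart_smul φ hc hf, map_smul, smul_eq_mul]; ring)
  refine ⟨m, n, hm, hn, fun f => ?_⟩
  have hi : ∀ (m : Measure X) [m.Regular] (f : C(X, ℝ)), Integrable f m := fun m _ f =>
    f.continuous.integrable_of_hasCompactSupport (HasCompactSupport.of_compactSpace f)
  have hpos : ∀ f : C(X, ℝ), 0 ≤ f → φ f = ∫ x, f x ∂m - ∫ x, f x ∂n := fun f hf => by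
    rw [hmf f hf, hnf f hf]; ring
  have hint : ∀ (m : Measure X) [m.Regular], ∫ x, f x ∂m = ∫ x, f⁺ x ∂m - ∫ x, f⁻ x ∂m := by
    intro m _
    rw [← integral_sub (hi m _) (hi m _)]
    refine integral_congr_ae (.of_forall fun x => ?_)
    exact congrArg (fun g : C(X, ℝ) => g x) (posPart_sub_negPart f).symm
  rw [hint m, hint n]
  conv_lhs => rw [← posPart_sub_negPart f, map_sub, hpos _ (posPart_nonneg f),
    hpos _ (negPart_nonneg f)]
  ring

/-- Real functions as complex ones. -/
noncomputable def ofRealMap : C(X, ℝ) →L[ℝ] C(X, ℂ) :=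
  Complex.ofRealCLM.compLeftContinuous ℝ X

lemma integralCLM_surjective : Function.Surjective (integralCLM X) := by
  intro Λ
  let Λr : C(X, ℝ) →L[ℝ] ℂ := (Λ.restrictScalars ℝ) ∘L ofRealMap
  obtain ⟨m₁, n₁, hm₁, hn₁, h₁⟩ := exists_measure_sub_measure (Complex.reCLM ∘L Λr)
  obtain ⟨m₂, n₂, hm₂, hn₂, h₂⟩ := exists_measure_sub_measure (Complex.imCLM ∘L Λr)
  have hfin : ∀ (m : Measure X) [m.Regular], IsFiniteMeasure m := fun m _ =>
    ⟨isCompact_univ.measure_lt_top⟩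
  have := hfin m₁
  have := hfin m₂
  have := hfin n₁
  have := hfin n₂
  let μ : RegularMeasure X :=
    (RegularMeasure.ofMeasure m₁ + (-1 : ℂ) • RegularMeasure.ofMeasure n₁) +
      Complex.I • (RegularMeasure.ofMeasure m₂ + (-1 : ℂ) • RegularMeasure.ofMeasure n₂)
  have hreal : ∀ (f : C(X, ℝ)) (m : Measure X) [IsFiniteMeasure m] [m.Regular],
      integralCLM X (RegularMeasure.ofMeasure m) (ofRealMap f) = ((∫ x, f x ∂m : ℝ) : ℂ) := by
    intro f m _ _
    rw [integralCLM_apply, cintegral_ofMeasure]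
    exact integral_ofReal
  have hμ : ∀ f : C(X, ℝ), integralCLM X μ (ofRealMap f) = Λ (ofRealMap f) := by
    intro f
    have e₁ : (Λ (ofRealMap f)).re = _ := h₁ f
    have e₂ : (Λ (ofRealMap f)).im = _ := h₂ f
    rw [← Complex.re_add_im (Λ (ofRealMap f)), e₁, e₂]
    simp only [μ, map_add, map_smul, _root_.add_apply, _root_.smul_apply, hreal, smul_eq_mul]
    push_cast
    ring
  refine ⟨μ, ContinuousLinearMap.ext fun f => ?_⟩
  let u : C(X, ℝ) := ⟨fun x => (f x).re, by fun_prop⟩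
  let v : C(X, ℝ) := ⟨fun x => (f x).im, by fun_prop⟩
  have hf : f = ofRealMap u + Complex.I • ofRealMap v := by
    ext x
    change f x = ((f x).re : ℂ) + Complex.I * ((f x).im : ℂ)
    rw [mul_comm, Complex.re_add_im]
  rw [hf, map_add, map_smul, hμ, hμ, map_add, map_smul]

variable (X) in
/-- The Riesz representation theorem for complex functionals: `M(X)` is the dual of `C(X)`. -/
noncomputable def rieszEquiv : RegularMeasure X ≃ₗᵢ[ℂ] StrongDual ℂ C(X, ℂ) :=
  LinearIsometryEquiv.ofSurjective
    { integralCLM X with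
      norm_map' := fun μ => (norm_integralCLM_le μ).antisymm (le_norm_integralCLM μ) }
    integralCLM_surjective

end Riesz

/-! ### The index of a monomial -/

section Index

variable {Γ : Type*} [AddCommGroup Γ]

section

variable (S : AddSubmonoid Γ)

lemma ext_clm_basisVec {E : Type*} [NormedAddCommGroup E] [NormedSpace ℂ E]
    {A B : EllTwo S →L[ℂ] E} (h : ∀ x, A (basisVec S x) = B (basisVec S x)) : A = B := by
  classical
  refine lp.ext_continuousLinearMap (by simp) fun y => ContinuousLinearMap.ext_ring ?_
  convert h y using 1 <;> simp [basisVec]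

lemma shiftOp_add (a b : S) : shiftOp S (a + b) = shiftOp S a * shiftOp S b :=
  ext_clm_basisVec S fun x => by
    rw [mul_apply_eq_comp, shiftOp_basisVec, shiftOp_basisVec, shiftOp_basisVec,
      add_assoc]

lemma shiftOp_add_apply (a b : S) (v : EllTwo S) :
    shiftOp S (a + b) v = shiftOp S a (shiftOp S b v) := by rw [shiftOp_add]; rfl

end

variable {S : AddSubmonoid Γ}

/-- A closed linear condition on the elements of the algebra can be checked on monomials. -/
lemma monomials_induction {P : Cred S → Prop} (mem : ∀ V ∈ monomials S, P V)
    (add : ∀ A B, P A → P B → P (A + B)) (smul : ∀ (c : ℂ) A, P A → P (c • A))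
    (closed : IsClosed {A | P A}) (A : Cred S) : P A := by
  have h0 : P 0 := by simpa using smul 0 _ (mem 1 (one_mem _))
  have hle : (Submodule.span ℂ (monomials S : Set (Cred S)) : Set (Cred S)) ⊆ {A | P A} := by
    intro B hB
    induction hB using Submodule.span_induction with
    | mem V hV => exact mem V hV
    | zero => exact h0
    | add A B _ _ hA hB => exact add A B hA hB
    | smul c A _ hA => exact smul c A hA
  exact closure_minimal hle closed (span_monomials_dense A)

lemma eq_of_eqOn_monomials {E : Type*} [NormedAddCommGroup E] [NormedSpace ℂ E]
    {L M : Cred S →L[ℂ] E} (h : ∀ V ∈ monomials S, L V = M V) : L = M := by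
  refine ContinuousLinearMap.ext fun A => monomials_induction (P := fun A => L A = M A) h ?_ ?_
    (isClosed_eq L.continuous M.continuous) A
  · intro A B hA hB
    rw [map_add, map_add, hA, hB]
  · intro c A hA
    rw [map_smul, map_smul, hA]

variable (S) in
/-- The operator `A` shifts by the index `c` far out in the semigroup: `A e_x = e_{c + x}` for all
`x` in some translate `s + S`. -/
def HasIndex (A : Cred S) (c : Γ) : Prop :=
  ∃ s : S, ∀ x : S, ∃ y : S, (y : Γ) = c + (s + x : S) ∧
    A.1 (basisVec S (s + x)) = basisVec S y

lemma hasIndex_gen (a : S) : HasIndex S (gen S a) a :=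
  ⟨0, fun x => ⟨a + (0 + x), rfl, shiftOp_basisVec S _ _⟩⟩

lemma hasIndex_one : HasIndex S 1 0 := ⟨0, fun x => ⟨0 + x, by simp, rfl⟩⟩

lemma hasIndex_star_gen (a : S) : HasIndex S (star (gen S a)) (-a) := by
  refine ⟨a, fun x => ⟨x, by simp, ?_⟩⟩
  have h : star (shiftOp S a) * shiftOp S a = 1 := by
    refine ext_basisVec S fun x y => ?_
    rw [mul_apply_eq_comp, ContinuousLinearMap.star_eq_adjoint,
      ContinuousLinearMap.adjoint_inner_right]
    exact LinearIsometry.inner_map_map _ _ _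
  have h2 := congrArg (fun A => A (basisVec S x)) h
  simp only [mul_apply_eq_comp, shiftOp_basisVec] at h2
  exact h2

lemma HasIndex.mul (hS : ∀ c : Γ, ∃ a ∈ S, ∃ b ∈ S, c = a - b) {A B : Cred S} {c d : Γ}
    (hA : HasIndex S A c) (hB : HasIndex S B d) : HasIndex S (A * B) (c + d) := by
  obtain ⟨s, hs⟩ := hA
  obtain ⟨t, ht⟩ := hB
  obtain ⟨p, hp, q, hq, rfl⟩ := hS d
  -- `B` maps `e_x` with `x ∈ t + q + s + S` to `e_y` with `y ∈ s + S`.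
  refine ⟨t + (⟨q, hq⟩ + s), fun x => ?_⟩
  obtain ⟨y, hy, hBy⟩ := ht (⟨q, hq⟩ + s + x)
  have hy' : y = s + (⟨p, hp⟩ + t + x) := by
    ext
    rw [hy]
    simp only [AddSubmonoid.coe_add]
    abel
  obtain ⟨z, hz, hAz⟩ := hs (⟨p, hp⟩ + t + x)
  refine ⟨z, ?_, ?_⟩
  · rw [hz, ← hy', hy]
    simp only [AddSubmonoid.coe_add]
    abel
  · rw [add_assoc t]
    change A.1 (B.1 _) = _
    rw [hBy, hy', hAz]

lemma exists_hasIndex (hS : ∀ c : Γ, ∃ a ∈ S, ∃ b ∈ S, c = a - b) {V : Cred S}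
    (hV : V ∈ monomials S) : ∃ c, HasIndex S V c := by
  induction hV using Submonoid.closure_induction with
  | mem V hV =>
    rcases hV with ⟨a, rfl⟩ | ⟨a, rfl⟩
    · exact ⟨_, hasIndex_gen a⟩
    · exact ⟨_, hasIndex_star_gen a⟩
  | one => exact ⟨_, hasIndex_one⟩
  | mul V W _ _ hV hW =>
    obtain ⟨c, hc⟩ := hV
    obtain ⟨d, hd⟩ := hW
    exact ⟨_, hc.mul hS hd⟩

lemma hasIndex_genDiff (hS : ∀ c : Γ, ∃ a ∈ S, ∃ b ∈ S, c = a - b) (a b : S) :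
    HasIndex S (genDiff S a b) (b - a) := by
  rw [sub_eq_neg_add]
  exact (hasIndex_star_gen a).mul hS (hasIndex_gen b)

lemma genDiff_mem_monomials (a b : S) : genDiff S a b ∈ monomials S :=
  mul_mem (Submonoid.subset_closure (Or.inr ⟨a, rfl⟩)) (Submonoid.subset_closure (Or.inl ⟨b, rfl⟩))

end Index

/-! ### Multiplication operators and the symbol map -/

section Symbol

variable {Γ : Type*} [AddCommGroup Γ] [TopologicalSpace Γ] [DiscreteTopology Γ]

instance : (haar Γ).Regular := by unfold haar; infer_instance

lemma denseRange_toLp :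
    DenseRange (ContinuousMap.toLp 2 (haar Γ) ℂ : C(DualGroup Γ, ℂ) →L[ℂ] _) :=
  ContinuousMap.toLp_denseRange ℂ (haar Γ) ℂ (by simp)

lemma ext_toLp {E : Type*} [NormedAddCommGroup E] [NormedSpace ℂ E]
    {A B : Lp ℂ 2 (haar Γ) →L[ℂ] E}
    (h : ∀ g : C(DualGroup Γ, ℂ), A (ContinuousMap.toLp 2 (haar Γ) ℂ g) =
      B (ContinuousMap.toLp 2 (haar Γ) ℂ g)) : A = B := by
  exact DFunLike.coe_injective (denseRange_toLp.equalizer A.continuous B.continuous (funext h))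

lemma mulOp_mul (f g : C(DualGroup Γ, ℂ)) : mulOp Γ (f * g) = mulOp Γ f * mulOp Γ g :=
  ext_toLp fun h => by
    rw [mul_apply_eq_comp, mulOp_toLp, mulOp_toLp, mulOp_toLp, mul_assoc]

lemma mulOp_one : mulOp Γ 1 = 1 :=
  ext_toLp fun h => by rw [mulOp_toLp, one_mul]; rfl

lemma mulOp_star (f : C(DualGroup Γ, ℂ)) : mulOp Γ (star f) = star (mulOp Γ f) := by
  refine ext_toLp fun g => ext_inner_left ℂ fun v => ?_
  rw [ContinuousLinearMap.star_eq_adjoint, ContinuousLinearMap.adjoint_inner_right]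
  refine denseRange_toLp.induction_on (p := fun v => inner ℂ v (mulOp Γ (star f) _) =
    inner ℂ (mulOp Γ f v) _) v (isClosed_eq (by fun_prop) (by fun_prop)) fun h => ?_
  rw [mulOp_toLp, mulOp_toLp, ContinuousMap.inner_toLp, ContinuousMap.inner_toLp]
  refine integral_congr_ae (.of_forall fun x => ?_)
  simp
  ring

variable (Γ) in
/-- The representation of `C(G)` on `L²(G)` by multiplication operators. -/
noncomputable def mulOpHom :
    C(DualGroup Γ, ℂ) →⋆ₐ[ℂ] (Lp ℂ 2 (haar Γ) →L[ℂ] Lp ℂ 2 (haar Γ)) where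
  toFun := mulOp Γ
  map_one' := mulOp_one
  map_mul' := mulOp_mul
  map_zero' := map_zero _
  map_add' := map_add _
  commutes' c := by
    rw [Algebra.algebraMap_eq_smul_one, map_smul, mulOp_one, Algebra.algebraMap_eq_smul_one]
  map_star' := mulOp_star

lemma mulOp_injective : Function.Injective (mulOp Γ) := by
  intro f g h
  have h1 := mulOp_toLp f 1
  rw [h, mulOp_toLp, mul_one, mul_one] at h1
  exact (ContinuousMap.toLp_injective (haar Γ) h1).symm

/-- Injective star-homomorphisms are isometric. -/
lemma norm_mulOp (f : C(DualGroup Γ, ℂ)) : ‖mulOp Γ f‖ = ‖f‖ :=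
  NonUnitalStarAlgHom.norm_map (mulOpHom Γ) mulOp_injective f

lemma norm_character_le (c : Γ) : ‖character c‖ ≤ 1 :=
  (ContinuousMap.norm_le _ zero_le_one).2 fun α => by
    rw [character_apply, Circle.norm_coe]

lemma dense_span_toLp_character : Dense (Submodule.span ℂ (Set.range fun c : Γ =>
    ContinuousMap.toLp 2 (haar Γ) ℂ (character c)) : Set (Lp ℂ 2 (haar Γ))) := by
  have h : Dense (Submodule.span ℂ (Set.range (character (Γ := Γ))) : Set C(DualGroup Γ, ℂ)) := by
    rw [Submodule.dense_iff_topologicalClosure_eq_top]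
    exact span_character_dense
  have h2 := denseRange_toLp.dense_image (ContinuousMap.toLp 2 (haar Γ) ℂ).continuous h
  refine h2.mono ?_
  rintro _ ⟨f, hf, rfl⟩
  have h3 := Submodule.mem_map_of_mem (f := (ContinuousMap.toLp 2 (haar Γ) ℂ :
    C(DualGroup Γ, ℂ) →L[ℂ] _).toLinearMap) hf
  rw [Submodule.map_span, ← Set.range_comp] at h3
  exact h3

variable (S : AddSubmonoid Γ)

lemma norm_fourierEmb (v : EllTwo S) : ‖fourierEmb S v‖ = ‖v‖ :=
  LinearIsometry.norm_map _ v

lemma mulOp_character_fourierEmb (a : S) (v : EllTwo S) :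
    mulOp Γ (character (a : Γ)) (fourierEmb S v) = fourierEmb S (shiftOp S a v) := by
  have : mulOp Γ (character (a : Γ)) ∘L fourierEmb S = fourierEmb S ∘L shiftOp S a :=
    ext_clm_basisVec S fun x => by
      simp only [ContinuousLinearMap.comp_apply]
      rw [shiftOp_basisVec, fourierEmb_basisVec, fourierEmb_basisVec, mulOp_toLp, character_mul]
      rfl
  exact congrArg (fun A => A v) this

/-- Pairs `(A, f)` such that `A` acts as multiplication by `f` far out in the semigroup: on the
subspace `T_s ℓ²(S)` for some `s`. -/
noncomputable def symbolGraph : Submodule ℂ (Cred S × C(DualGroup Γ, ℂ)) where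
  carrier := {p | ∃ s : S, ∀ v, fourierEmb S (p.1.1 (shiftOp S s v)) =
    mulOp Γ p.2 (fourierEmb S (shiftOp S s v))}
  zero_mem' := ⟨0, fun v => by simp⟩
  add_mem' := by
    rintro p q ⟨s, hs⟩ ⟨t, ht⟩
    refine ⟨s + t, fun v => ?_⟩
    have h1 := hs (shiftOp S t v)
    have h2 := ht (shiftOp S s v)
    rw [← shiftOp_add_apply] at h1 h2
    rw [add_comm t s] at h2
    simp [h1, h2]
  smul_mem' := by
    rintro c p ⟨s, hs⟩
    exact ⟨s, fun v => by simp [hs v]⟩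

variable {S}

/-- Every trigonometric polynomial is moved into `F (T_s ℓ²(S))` by a character in `S`. -/
lemma exists_translate_mem (hS : ∀ c : Γ, ∃ a ∈ S, ∃ b ∈ S, c = a - b) (s : S)
    {g : Lp ℂ 2 (haar Γ)} (hg : g ∈ Submodule.span ℂ (Set.range fun c : Γ =>
      ContinuousMap.toLp 2 (haar Γ) ℂ (character c))) :
    ∃ (t : S) (v : EllTwo S), mulOp Γ (character (t : Γ)) g = fourierEmb S (shiftOp S s v) := by
  induction hg using Submodule.span_induction with
  | mem g hg =>
    obtain ⟨c, rfl⟩ := hg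
    obtain ⟨a, ha, b, hb, rfl⟩ := hS c
    refine ⟨⟨b, hb⟩ + s, basisVec S ⟨a, ha⟩, ?_⟩
    rw [shiftOp_basisVec, fourierEmb_basisVec]
    beta_reduce
    rw [mulOp_toLp, character_mul]
    congr 2
    simp only [AddSubmonoid.coe_add]
    abel
  | zero => exact ⟨0, 0, by simp⟩
  | add g₁ g₂ _ _ h₁ h₂ =>
    obtain ⟨t₁, v₁, h₁⟩ := h₁
    obtain ⟨t₂, v₂, h₂⟩ := h₂
    refine ⟨t₁ + t₂, shiftOp S t₂ v₁ + shiftOp S t₁ v₂, ?_⟩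
    have e₁ : mulOp Γ (character ((t₁ + t₂ : S) : Γ)) g₁ =
        fourierEmb S (shiftOp S s (shiftOp S t₂ v₁)) := by
      rw [AddSubmonoid.coe_add, add_comm, ← character_mul, mulOp_mul,
        mul_apply_eq_comp, h₁, mulOp_character_fourierEmb,
        ← shiftOp_add_apply, add_comm, shiftOp_add_apply]
    have e₂ : mulOp Γ (character ((t₁ + t₂ : S) : Γ)) g₂ =
        fourierEmb S (shiftOp S s (shiftOp S t₁ v₂)) := by
      rw [AddSubmonoid.coe_add, ← character_mul, mulOp_mul,
        mul_apply_eq_comp, h₂, mulOp_character_fourierEmb,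
        ← shiftOp_add_apply, add_comm, shiftOp_add_apply]
    rw [map_add, e₁, e₂, map_add, map_add]
  | smul c g _ h =>
    obtain ⟨t, v, h⟩ := h
    exact ⟨t, c • v, by rw [map_smul, h, map_smul, map_smul]⟩

lemma norm_mulOp_character_le (c : Γ) (g : Lp ℂ 2 (haar Γ)) :
    ‖mulOp Γ (character c) g‖ ≤ ‖g‖ := by
  refine ((mulOp Γ (character c)).le_of_opNorm_le ?_ g).trans_eq (one_mul _)
  rw [norm_mulOp]
  exact norm_character_le c

/-- An operator dominates its symbol: multiplication by a character carries trigonometric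
polynomials isometrically to the region where `A` acts as multiplication by `f`. -/
lemma norm_le_of_mem_symbolGraph (hS : ∀ c : Γ, ∃ a ∈ S, ∃ b ∈ S, c = a - b)
    {A : Cred S} {f : C(DualGroup Γ, ℂ)} (h : (A, f) ∈ symbolGraph S) : ‖f‖ ≤ ‖A‖ := by
  obtain ⟨s, hs⟩ := h
  rw [← norm_mulOp f]
  refine ContinuousLinearMap.opNorm_le_bound _ (norm_nonneg _) fun g => ?_
  refine dense_span_toLp_character.induction (P := fun g => ‖mulOp Γ f g‖ ≤ ‖A‖ * ‖g‖)
    (fun g hg => ?_) (isClosed_le (by fun_prop) (by fun_prop)) g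
  obtain ⟨t, v, hv⟩ := exists_translate_mem hS s hg
  have h1 : mulOp Γ f g = mulOp Γ (character (-(t : Γ)))
      (mulOp Γ f (mulOp Γ (character (t : Γ)) g)) := by
    rw [← mul_apply_eq_comp, ← mul_apply_eq_comp, ← mulOp_mul,
      ← mulOp_mul, mul_right_comm, character_mul, neg_add_cancel, character_zero, one_mul]
  calc ‖mulOp Γ f g‖ ≤ ‖mulOp Γ f (mulOp Γ (character (t : Γ)) g)‖ := by
        rw [h1]; exact norm_mulOp_character_le _ _
    _ = ‖A.1 (shiftOp S s v)‖ := by rw [hv, ← hs v, norm_fourierEmb]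
    _ ≤ ‖A‖ * ‖shiftOp S s v‖ := A.1.le_opNorm _
    _ = ‖A‖ * ‖mulOp Γ (character (t : Γ)) g‖ := by rw [hv, norm_fourierEmb]
    _ ≤ ‖A‖ * ‖g‖ := by gcongr; exact norm_mulOp_character_le _ _

lemma HasIndex.mem_symbolGraph {A : Cred S} {c : Γ} (hA : HasIndex S A c) :
    (A, character c) ∈ symbolGraph S := by
  obtain ⟨s, hs⟩ := hA
  refine ⟨s, fun v => ?_⟩
  have : fourierEmb S ∘L A.1 ∘L shiftOp S s =
      mulOp Γ (character c) ∘L fourierEmb S ∘L shiftOp S s := by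
    refine ext_clm_basisVec S fun x => ?_
    obtain ⟨y, hy, hAy⟩ := hs x
    simp only [ContinuousLinearMap.comp_apply]
    rw [shiftOp_basisVec, hAy, fourierEmb_basisVec, fourierEmb_basisVec, mulOp_toLp, character_mul,
      hy]
  exact congrArg (fun A => A v) this

/-- The operator of a pair in the symbol graph. -/
noncomputable def symbolGraphFst (S : AddSubmonoid Γ) : symbolGraph S →ₗ[ℂ] Cred S :=
  LinearMap.fst ℂ _ _ ∘ₗ (symbolGraph S).subtype

/-- The function of a pair in the symbol graph. -/
noncomputable def symbolGraphSnd (S : AddSubmonoid Γ) :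
    symbolGraph S →ₗ[ℂ] C(DualGroup Γ, ℂ) :=
  LinearMap.snd ℂ _ _ ∘ₗ (symbolGraph S).subtype

/-- The symbol map `σ : C*_red(S) → C(G)`, the extension by continuity of `A ↦ f`, `(A, f)` in the
symbol graph. It sends a monomial of index `c` to `χ^c`. -/
noncomputable def symbolMap (S : AddSubmonoid Γ) : Cred S →L[ℂ] C(DualGroup Γ, ℂ) :=
  (symbolGraphSnd S).extendOfNorm (symbolGraphFst S)

section

variable (hS : ∀ c : Γ, ∃ a ∈ S, ∃ b ∈ S, c = a - b)

include hS

lemma denseRange_symbolGraphFst : DenseRange (symbolGraphFst S) := by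
  have hle : Submodule.span ℂ (monomials S : Set (Cred S)) ≤
      LinearMap.range (symbolGraphFst S) := by
    rw [Submodule.span_le]
    intro V hV
    obtain ⟨c, hc⟩ := exists_hasIndex hS hV
    exact ⟨⟨_, hc.mem_symbolGraph⟩, rfl⟩
  intro A
  exact closure_mono hle (span_monomials_dense A)

lemma norm_symbolGraphSnd_le (p : symbolGraph S) :
    ‖symbolGraphSnd S p‖ ≤ 1 * ‖symbolGraphFst S p‖ := by
  rw [one_mul]
  exact norm_le_of_mem_symbolGraph hS p.2

lemma norm_symbolMap_le (A : Cred S) : ‖symbolMap S A‖ ≤ ‖A‖ :=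
  (LinearMap.norm_extendOfNorm_apply_le (denseRange_symbolGraphFst (S := S) hS) 1
    (norm_symbolGraphSnd_le (S := S) hS) A).trans_eq (one_mul _)

lemma symbolMap_of_mem {A : Cred S} {f : C(DualGroup Γ, ℂ)} (h : (A, f) ∈ symbolGraph S) :
    symbolMap S A = f :=
  LinearMap.extendOfNorm_eq (denseRange_symbolGraphFst (S := S) hS)
    ⟨1, norm_symbolGraphSnd_le (S := S) hS⟩ ⟨_, h⟩

lemma HasIndex.symbolMap_eq {A : Cred S} {c : Γ} (hA : HasIndex S A c) :
    symbolMap S A = character c := symbolMap_of_mem hS hA.mem_symbolGraph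

/-- On monomials this is additivity of the index; the rest is linearity and density. -/
lemma symbolMap_mul (A B : Cred S) : symbolMap S (A * B) = symbolMap S A * symbolMap S B := by
  have h1 : ∀ V ∈ monomials S, ∀ B, symbolMap S (V * B) = symbolMap S V * symbolMap S B := by
    intro V hV
    refine monomials_induction
      (P := fun B => symbolMap S (V * B) = symbolMap S V * symbolMap S B) (fun W hW => ?_)
      (fun A B hA hB => ?_) (fun c A hA => ?_) (isClosed_eq (by fun_prop) (by fun_prop))
    · obtain ⟨c, hc⟩ := exists_hasIndex hS hV
      obtain ⟨d, hd⟩ := exists_hasIndex hS hW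
      rw [hc.symbolMap_eq hS, hd.symbolMap_eq hS, (hc.mul hS hd).symbolMap_eq hS, character_mul]
    · calc symbolMap S (V * (A + B)) = symbolMap S (V * A + V * B) :=
            congrArg (symbolMap S) (mul_add V A B)
        _ = symbolMap S (V * A) + symbolMap S (V * B) := map_add _ _ _
        _ = symbolMap S V * symbolMap S A + symbolMap S V * symbolMap S B :=
            congrArg₂ (· + ·) hA hB
        _ = symbolMap S V * (symbolMap S A + symbolMap S B) := (mul_add _ _ _).symm
        _ = _ := congrArg (symbolMap S V * ·) (map_add (symbolMap S) A B).symm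
    · calc symbolMap S (V * (c • A)) = symbolMap S (c • (V * A)) :=
            congrArg (symbolMap S) (mul_smul_comm c V A)
        _ = c • symbolMap S (V * A) := map_smul _ _ _
        _ = c • (symbolMap S V * symbolMap S A) := congrArg (c • ·) hA
        _ = symbolMap S V * (c • symbolMap S A) := (mul_smul_comm _ _ _).symm
        _ = _ := congrArg (symbolMap S V * ·) (map_smul (symbolMap S) c A).symm
  refine monomials_induction (P := fun A => symbolMap S (A * B) = symbolMap S A * symbolMap S B)
    (fun V hV => h1 V hV B) (fun A A' hA hA' => ?_) (fun c A hA => ?_)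
    (isClosed_eq (by fun_prop) (by fun_prop)) A
  · calc symbolMap S ((A + A') * B) = symbolMap S (A * B + A' * B) :=
          congrArg (symbolMap S) (add_mul A A' B)
      _ = symbolMap S (A * B) + symbolMap S (A' * B) := map_add _ _ _
      _ = symbolMap S A * symbolMap S B + symbolMap S A' * symbolMap S B :=
          congrArg₂ (· + ·) hA hA'
      _ = (symbolMap S A + symbolMap S A') * symbolMap S B := (add_mul _ _ _).symm
      _ = _ := congrArg (· * symbolMap S B) (map_add (symbolMap S) A A').symm
  · calc symbolMap S (c • A * B) = symbolMap S (c • (A * B)) :=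
          congrArg (symbolMap S) (smul_mul_assoc c A B)
      _ = c • symbolMap S (A * B) := map_smul _ _ _
      _ = c • (symbolMap S A * symbolMap S B) := congrArg (c • ·) hA
      _ = (c • symbolMap S A) * symbolMap S B := (smul_mul_assoc _ _ _).symm
      _ = _ := congrArg (· * symbolMap S B) (map_smul (symbolMap S) c A).symm

lemma symbolMap_eq_zero {A : Cred S} (hA : A ∈ commutatorIdeal S) : symbolMap S A = 0 := by
  have h : Submodule.span ℂ {X | ∃ (A B : Cred S) (a b a' b' : S),
      X = A * (genDiff S a b * genDiff S a' b' - genDiff S a' b' * genDiff S a b) * B} ≤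
      LinearMap.ker (symbolMap S).toLinearMap := by
    rw [Submodule.span_le]
    rintro _ ⟨A, B, a, b, a', b', rfl⟩
    simp only [SetLike.mem_coe, LinearMap.mem_ker, ContinuousLinearMap.coe_coe]
    rw [symbolMap_mul hS, symbolMap_mul hS, map_sub, symbolMap_mul hS, symbolMap_mul hS,
      mul_comm (symbolMap S (genDiff S a b)), sub_self, mul_zero, zero_mul]
  exact Submodule.topologicalClosure_minimal _ h (symbolMap S).isClosed_ker hA

end

lemma rho_character_sub (hS : ∀ c : Γ, ∃ a ∈ S, ∃ b ∈ S, c = a - b) (a b : S) :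
    rho hS (character ((b : Γ) - a)) = genDiff S a b :=
  Subtype.ext (toeplitz_character S a b)

lemma ext_character {E : Type*} [NormedAddCommGroup E] [NormedSpace ℂ E]
    {L M : C(DualGroup Γ, ℂ) →L[ℂ] E} (h : ∀ c, L (character c) = M (character c)) : L = M := by
  refine ContinuousLinearMap.ext_on (s := Set.range character) ?_ (by rintro _ ⟨c, rfl⟩; exact h c)
  rw [Submodule.dense_iff_topologicalClosure_eq_top]
  exact span_character_dense

lemma symbolMap_rho (hS : ∀ c : Γ, ∃ a ∈ S, ∃ b ∈ S, c = a - b) (f : C(DualGroup Γ, ℂ)) :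
    symbolMap S (rho hS f) = f := by
  have : symbolMap S ∘L rho hS = ContinuousLinearMap.id ℂ _ := ext_character fun c => by
    obtain ⟨b, hb, a, ha, rfl⟩ := hS c
    have := rho_character_sub hS ⟨a, ha⟩ ⟨b, hb⟩
    simp only [ContinuousLinearMap.comp_apply] at this ⊢
    rw [this]
    exact (hasIndex_genDiff hS ⟨a, ha⟩ ⟨b, hb⟩).symbolMap_eq hS
  exact congrArg (fun L => L f) this

lemma norm_rho_le (hS : ∀ c : Γ, ∃ a ∈ S, ∃ b ∈ S, c = a - b) (f : C(DualGroup Γ, ℂ)) :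
    ‖rho hS f‖ ≤ ‖f‖ := by
  have hF : ‖fourierEmb S‖ ≤ 1 := ContinuousLinearMap.opNorm_le_bound _ zero_le_one fun v => by
    rw [norm_fourierEmb, one_mul]
  change ‖toeplitz S f‖ ≤ ‖f‖
  rw [toeplitz_apply]
  calc _ ≤ ‖(fourierEmb S).adjoint‖ * (‖mulOp Γ f‖ * ‖fourierEmb S‖) :=
        (ContinuousLinearMap.opNorm_comp_le _ _).trans
          (mul_le_mul_of_nonneg_left (ContinuousLinearMap.opNorm_comp_le _ _) (norm_nonneg _))
    _ ≤ 1 * (‖f‖ * 1) := by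
        rw [LinearIsometryEquiv.norm_map, norm_mulOp]
        gcongr
    _ = ‖f‖ := by ring

end Symbol

/-! ### Monomials modulo the commutator ideal -/

section CommutatorIdeal

variable {Γ : Type*} [AddCommGroup Γ] (S : AddSubmonoid Γ)

lemma gen_zero : gen S 0 = 1 :=
  Subtype.ext (ext_clm_basisVec S fun x => by
    change shiftOp S 0 (basisVec S x) = basisVec S x
    rw [shiftOp_basisVec, zero_add])

lemma gen_add (a b : S) : gen S (a + b) = gen S a * gen S b :=
  Subtype.ext (shiftOp_add S a b)

lemma genDiff_zero_left (a : S) : genDiff S 0 a = gen S a := by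
  rw [genDiff, gen_zero, star_one, one_mul]

lemma genDiff_zero_right (a : S) : genDiff S a 0 = star (gen S a) := by
  rw [genDiff, gen_zero, mul_one]

/-- The two-sided ideal generated algebraically by the commutators. -/
noncomputable def algCommutatorIdeal : Submodule ℂ (Cred S) :=
  Submodule.span ℂ {X | ∃ (A B : Cred S) (a b a' b' : S),
    X = A * (genDiff S a b * genDiff S a' b' - genDiff S a' b' * genDiff S a b) * B}

variable {S}

lemma algCommutatorIdeal_le : algCommutatorIdeal S ≤ commutatorIdeal S :=
  Submodule.le_topologicalClosure _

lemma mul_mul_mem_algCommutatorIdeal {X : Cred S} (hX : X ∈ algCommutatorIdeal S) (A B : Cred S) :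
    A * X * B ∈ algCommutatorIdeal S := by
  induction hX using Submodule.span_induction with
  | mem X hX =>
    obtain ⟨A', B', a, b, a', b', rfl⟩ := hX
    exact Submodule.subset_span ⟨A * A', B' * B, a, b, a', b', by simp only [mul_assoc]⟩
  | zero => rw [mul_zero, zero_mul]; exact zero_mem _
  | add X Y _ _ hX hY => rw [mul_add, add_mul]; exact add_mem hX hY
  | smul c X _ hX =>
    rw [mul_smul_comm, smul_mul_assoc]
    exact Submodule.smul_mem _ c hX

lemma mul_star_gen_sub_mem (a b : S) :
    gen S b * star (gen S a) - star (gen S a) * gen S b ∈ algCommutatorIdeal S :=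
  Submodule.subset_span ⟨1, 1, 0, b, a, 0, by
    rw [genDiff_zero_left, genDiff_zero_right, one_mul, mul_one]⟩

lemma mul_sub_mul_mul_mul {R : Type*} [Ring R] (V W a b c d : R) :
    V * W - a * c * (b * d) =
      1 * (V - a * b) * W + a * b * (W - c * d) * 1 + a * (b * c - c * b) * d := by
  noncomm_ring

/-- Modulo the commutator ideal, every monomial is one of the operators `T_a^* T_b`. -/
lemma exists_sub_genDiff_mem {V : Cred S} (hV : V ∈ monomials S) :
    ∃ a b : S, V - genDiff S a b ∈ algCommutatorIdeal S := by
  induction hV using Submonoid.closure_induction with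
  | mem V hV =>
    rcases hV with ⟨a, rfl⟩ | ⟨a, rfl⟩
    · exact ⟨0, a, by rw [genDiff_zero_left, sub_self]; exact zero_mem _⟩
    · exact ⟨a, 0, by
        beta_reduce
        rw [genDiff_zero_right, sub_self]; exact zero_mem _⟩
  | one => exact ⟨0, 0, by rw [genDiff_zero_left, gen_zero, sub_self]; exact zero_mem _⟩
  | mul V W _ _ hV hW =>
    obtain ⟨a, b, hV⟩ := hV
    obtain ⟨c, d, hW⟩ := hW
    refine ⟨c + a, b + d, ?_⟩
    rw [genDiff, gen_add, gen_add, star_mul, mul_sub_mul_mul_mul]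
    exact add_mem (add_mem (mul_mul_mem_algCommutatorIdeal hV _ _)
      (mul_mul_mem_algCommutatorIdeal hW _ _))
      (mul_mul_mem_algCommutatorIdeal (mul_star_gen_sub_mem c b) _ _)

end CommutatorIdeal

/-! ### Convolution of functionals on a compact group -/

section Convolution

variable {G : Type*} [TopologicalSpace G] [Mul G] [ContinuousMul G]

/-- The left translates `y ↦ f (x * y)` of `f`, as a continuous function of `x`. -/
noncomputable def translates (f : C(G, ℂ)) : C(G, C(G, ℂ)) :=
  ContinuousMap.curry ⟨fun p : G × G => f (p.1 * p.2), by fun_prop⟩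

variable [CompactSpace G]

/-- The operator `f ↦ (x ↦ Λ (y ↦ f (x * y)))` on `C(G)` given by a functional `Λ`. -/
noncomputable def sliceMap (Λ : StrongDual ℂ C(G, ℂ)) : C(G, ℂ) →L[ℂ] C(G, ℂ) :=
  LinearMap.mkContinuous
    { toFun := fun f => ⟨fun x => Λ (translates f x), by fun_prop⟩
      map_add' := fun f g => by
        ext x
        exact map_add Λ (translates f x) (translates g x)
      map_smul' := fun c f => by
        ext x
        exact map_smul Λ c (translates f x) } ‖Λ‖ fun f =>
    (ContinuousMap.norm_le _ (by positivity)).2 fun x => by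
      refine (Λ.le_opNorm _).trans ?_
      gcongr
      exact (ContinuousMap.norm_le _ (norm_nonneg _)).2 fun y => f.norm_coe_le_norm _

lemma sliceMap_apply (Λ : StrongDual ℂ C(G, ℂ)) (f : C(G, ℂ)) (x : G) :
    sliceMap Λ f x = Λ (translates f x) := rfl

lemma norm_sliceMap_le (Λ : StrongDual ℂ C(G, ℂ)) : ‖sliceMap Λ‖ ≤ ‖Λ‖ :=
  LinearMap.mkContinuous_norm_le _ (norm_nonneg _) _

/-- The convolution of functionals on `C(G)`. -/
noncomputable def convFunctional :
    StrongDual ℂ C(G, ℂ) →ₗ[ℂ] StrongDual ℂ C(G, ℂ) →ₗ[ℂ] StrongDual ℂ C(G, ℂ) :=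
  LinearMap.mk₂ ℂ (fun Λ M => Λ ∘L sliceMap M) (fun _ _ _ => rfl) (fun _ _ _ => rfl)
    (fun Λ M N => ContinuousLinearMap.ext fun f => map_add Λ (sliceMap M f) (sliceMap N f))
    (fun c Λ M => ContinuousLinearMap.ext fun f => map_smul Λ c (sliceMap M f))

lemma convFunctional_apply (Λ M : StrongDual ℂ C(G, ℂ)) (f : C(G, ℂ)) :
    convFunctional Λ M f = Λ (sliceMap M f) := rfl

lemma norm_convFunctional_le (Λ M : StrongDual ℂ C(G, ℂ)) :
    ‖convFunctional Λ M‖ ≤ ‖Λ‖ * ‖M‖ :=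
  (ContinuousLinearMap.opNorm_comp_le _ _).trans (by gcongr; exact norm_sliceMap_le M)

end Convolution

/-! ### The annihilator of the commutator ideal -/

section Perp

variable {Γ : Type*} [AddCommGroup Γ] {S : AddSubmonoid Γ}

variable (S) in
/-- The annihilator `K^⊥` of the commutator ideal, as a Banach space. It is a type synonym, so that
its norm and linear structure are constants instead of instance terms built from those of the
operator algebra. -/
def CommutatorPerp : Type _ := annihilator (commutatorIdeal S)

noncomputable instance : NormedAddCommGroup (CommutatorPerp S) :=
  (inferInstance : NormedAddCommGroup (annihilator (commutatorIdeal S)))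

set_option maxSynthPendingDepth 3 in
noncomputable instance : NormedSpace ℂ (CommutatorPerp S) :=
  (inferInstance : NormedSpace ℂ (annihilator (commutatorIdeal S)))

/-- An element of `K^⊥`, as a functional. -/
def CommutatorPerp.toDual (ξ : CommutatorPerp S) : StrongDual ℂ (Cred S) :=
  Subtype.val (p := (· ∈ annihilator (commutatorIdeal S))) ξ

lemma CommutatorPerp.toDual_mem (ξ : CommutatorPerp S) :
    ξ.toDual ∈ annihilator (commutatorIdeal S) :=
  Subtype.property (p := (· ∈ annihilator (commutatorIdeal S))) ξ

end Perp

section Dual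

variable {Γ : Type*} [AddCommGroup Γ] [TopologicalSpace Γ] [DiscreteTopology Γ]

/-- The characters are the coefficient functions on which convolution acts as multiplication. -/
lemma convFunctional_character (Λ M : StrongDual ℂ C(DualGroup Γ, ℂ)) (c : Γ) :
    convFunctional Λ M (character c) = Λ (character c) * M (character c) := by
  have h : sliceMap M (character c) = M (character c) • character c := by
    ext x
    have h1 : translates (character c) x = character c x • character c := by
      ext y
      exact congrArg (fun z : Circle => (z : ℂ)) (rfl : (x * y) (Multiplicative.ofAdd c) = _)
    rw [sliceMap_apply, h1, map_smul, smul_eq_mul, mul_comm]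
    rfl
  rw [convFunctional_apply, h, map_smul, smul_eq_mul, mul_comm]

variable {S : AddSubmonoid Γ} (hS : ∀ c : Γ, ∃ a ∈ S, ∃ b ∈ S, c = a - b)

include hS in
lemma exists_symbolMap_eq_character {V : Cred S} (hV : V ∈ monomials S) :
    ∃ c, symbolMap S V = character c := by
  obtain ⟨c, hc⟩ := exists_hasIndex hS hV
  exact ⟨c, hc.symbolMap_eq hS⟩

lemma rho_character_mem_monomials (c : Γ) : rho hS (character c) ∈ monomials S := by
  obtain ⟨b, hb, a, ha, rfl⟩ := hS c
  have h := rho_character_sub hS ⟨a, ha⟩ ⟨b, hb⟩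
  simp only at h
  rw [h]
  exact genDiff_mem_monomials _ _

/-- A functional vanishing on the commutator ideal factors through the symbol. -/
lemma apply_rho_symbolMap {ξ : StrongDual ℂ (Cred S)} (hξ : ξ ∈ annihilator (commutatorIdeal S))
    (A : Cred S) : ξ (rho hS (symbolMap S A)) = ξ A := by
  have : (ξ ∘L rho hS) ∘L symbolMap S = ξ := by
    refine eq_of_eqOn_monomials fun V hV => ?_
    obtain ⟨a, b, hab⟩ := exists_sub_genDiff_mem hV
    have hab := algCommutatorIdeal_le hab
    have h1 : symbolMap S V = character ((b : Γ) - a) := by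
      rw [← (hasIndex_genDiff hS a b).symbolMap_eq hS, ← sub_eq_zero, ← map_sub]
      exact symbolMap_eq_zero hS hab
    have h2 : ξ (V - genDiff S a b) = 0 := hξ _ hab
    rw [map_sub, sub_eq_zero] at h2
    rw [ContinuousLinearMap.comp_apply, ContinuousLinearMap.comp_apply, h1, rho_character_sub, h2]
  exact congrArg (fun ζ => ζ A) this

lemma norm_comp_rho_le (ξ : StrongDual ℂ (Cred S)) : ‖ξ ∘L rho hS‖ ≤ ‖ξ‖ :=
  ContinuousLinearMap.opNorm_le_bound (ξ ∘L rho hS) (norm_nonneg ξ) fun f =>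
    ξ.le_opNorm_of_le (norm_rho_le hS f)

include hS in
lemma norm_comp_symbolMap_le (Λ : StrongDual ℂ C(DualGroup Γ, ℂ)) :
    ‖Λ ∘L symbolMap S‖ ≤ ‖Λ‖ :=
  ContinuousLinearMap.opNorm_le_bound (Λ ∘L symbolMap S) (norm_nonneg Λ) fun A =>
    Λ.le_opNorm_of_le (norm_symbolMap_le hS A)

lemma comp_rho_comp_symbolMap {ξ : StrongDual ℂ (Cred S)}
    (hξ : ξ ∈ annihilator (commutatorIdeal S)) : (ξ ∘L rho hS) ∘L symbolMap S = ξ :=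
  ContinuousLinearMap.ext (apply_rho_symbolMap hS hξ)

/-- Restriction along `ρ` is isometric on `K^⊥`: both `ρ` and `σ` are contractions. -/
lemma norm_comp_rho {ξ : StrongDual ℂ (Cred S)}
    (hξ : ξ ∈ annihilator (commutatorIdeal S)) : ‖ξ ∘L rho hS‖ = ‖ξ‖ := by
  refine le_antisymm (norm_comp_rho_le hS ξ) ?_
  have h := norm_comp_symbolMap_le hS (ξ ∘L rho hS)
  rwa [comp_rho_comp_symbolMap hS hξ] at h

include hS in
lemma comp_symbolMap_mem (Λ : StrongDual ℂ C(DualGroup Γ, ℂ)) :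
    Λ ∘L symbolMap S ∈ annihilator (commutatorIdeal S) := fun A hA => by
  rw [ContinuousLinearMap.comp_apply, symbolMap_eq_zero hS hA, map_zero]

variable (Γ) in
/-- The dual space of `C(G)`, again as a type synonym with constant instances. -/
def FunctionalSpace : Type _ := StrongDual ℂ C(DualGroup Γ, ℂ)

noncomputable instance : NormedAddCommGroup (FunctionalSpace Γ) :=
  inferInstanceAs (NormedAddCommGroup (StrongDual ℂ C(DualGroup Γ, ℂ)))

noncomputable instance : NormedSpace ℂ (FunctionalSpace Γ) :=
  inferInstanceAs (NormedSpace ℂ (StrongDual ℂ C(DualGroup Γ, ℂ)))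

instance : CompleteSpace (FunctionalSpace Γ) :=
  inferInstanceAs (CompleteSpace (StrongDual ℂ C(DualGroup Γ, ℂ)))

/-- The functional `ξ ∘ ρ` on `C(G)`. -/
noncomputable def restrictRho (ξ : CommutatorPerp S) : FunctionalSpace Γ := ξ.toDual ∘L rho hS

/-- The functional `Λ ∘ σ` on the algebra, `σ` the symbol map. -/
noncomputable def extendSymbol (Λ : FunctionalSpace Γ) : CommutatorPerp S :=
  Subtype.mk (p := (· ∈ annihilator (commutatorIdeal S)))
    ((show StrongDual ℂ C(DualGroup Γ, ℂ) from Λ) ∘L symbolMap S) (comp_symbolMap_mem hS _)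

/-- The isometric isomorphism of `K^⊥` with the dual of `C(G)`, `ξ ↦ ξ ∘ ρ`. -/
noncomputable def annihilatorEquiv : CommutatorPerp S ≃ₗᵢ[ℂ] FunctionalSpace Γ where
  toFun := restrictRho hS
  map_add' _ _ := rfl
  map_smul' _ _ := rfl
  invFun := extendSymbol hS
  left_inv ξ := Subtype.ext (comp_rho_comp_symbolMap hS ξ.toDual_mem)
  right_inv Λ := ContinuousLinearMap.ext fun f =>
    congrArg (show StrongDual ℂ C(DualGroup Γ, ℂ) from Λ) (symbolMap_rho hS f)
  norm_map' ξ := norm_comp_rho hS ξ.toDual_mem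

/-- The value of a functional on `C(G)`. -/
noncomputable def FunctionalSpace.eval (Λ : FunctionalSpace Γ) (f : C(DualGroup Γ, ℂ)) : ℂ :=
  (show StrongDual ℂ C(DualGroup Γ, ℂ) from Λ) f

lemma toDual_annihilatorEquiv_symm (Λ : FunctionalSpace Γ) (f : C(DualGroup Γ, ℂ)) :
    ((annihilatorEquiv hS).symm Λ).toDual (rho hS f) = Λ.eval f :=
  congrArg (fun M => FunctionalSpace.eval M f) ((annihilatorEquiv hS).apply_symm_apply Λ)

/-- The value of a functional on `ρ(χ^c)`, the Fourier coefficient of the corresponding measure. -/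
noncomputable def fourierCoeff (ξ : StrongDual ℂ (Cred S)) (c : Γ) : ℂ := ξ (rho hS (character c))

/-- An element of `K^⊥` is determined by its Fourier coefficients, like a measure on `G`. -/
lemma ext_fourierCoeff {ξ η : CommutatorPerp S}
    (h : ∀ c, fourierCoeff hS ξ.toDual c = fourierCoeff hS η.toDual c) : ξ = η :=
  (annihilatorEquiv hS).injective (ext_character h)

/-- The convolution of functionals on the dual group. -/
noncomputable def conv : FunctionalSpace Γ →ₗ[ℂ] FunctionalSpace Γ →ₗ[ℂ] FunctionalSpace Γ :=
  convFunctional (G := DualGroup Γ)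

lemma norm_conv_le (Λ M : FunctionalSpace Γ) : ‖conv Λ M‖ ≤ ‖Λ‖ * ‖M‖ :=
  norm_convFunctional_le (G := DualGroup Γ) Λ M

lemma eval_conv_character (Λ M : FunctionalSpace Γ) (c : Γ) :
    (conv Λ M).eval (character c) = Λ.eval (character c) * M.eval (character c) :=
  convFunctional_character Λ M c

/-- The product of `K^⊥`, transported from the convolution of functionals on `C(G)`. -/
noncomputable def annihilatorMul :
    CommutatorPerp S →ₗ[ℂ] CommutatorPerp S →ₗ[ℂ] CommutatorPerp S :=
  (conv.compl₁₂ (annihilatorEquiv hS).toLinearEquiv.toLinearMap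
    (annihilatorEquiv hS).toLinearEquiv.toLinearMap).compr₂
      (annihilatorEquiv hS).toLinearEquiv.symm.toLinearMap

lemma annihilatorMul_apply (ξ η : CommutatorPerp S) :
    annihilatorMul hS ξ η =
      (annihilatorEquiv hS).symm (conv (annihilatorEquiv hS ξ) (annihilatorEquiv hS η)) := rfl

lemma fourierCoeff_annihilatorMul (ξ η : CommutatorPerp S) (c : Γ) :
    fourierCoeff hS (annihilatorMul hS ξ η).toDual c =
      fourierCoeff hS ξ.toDual c * fourierCoeff hS η.toDual c :=
  (toDual_annihilatorEquiv_symm hS (conv (annihilatorEquiv hS ξ) (annihilatorEquiv hS η))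
    (character c)).trans (eval_conv_character _ _ c)

/-- On `K^⊥` the product of the dual is determined by the Fourier coefficients, since a functional
in `K^⊥` depends on a monomial only through its index. -/
lemma isDualProduct_of_fourierCoeff {ξ η ζ : CommutatorPerp S}
    (h : ∀ c, fourierCoeff hS ζ.toDual c = fourierCoeff hS ξ.toDual c * fourierCoeff hS η.toDual c) :
    IsDualProduct ξ.toDual η.toDual ζ.toDual := by
  refine (isDualProduct_iff _ _ _).2 fun V hV => ?_
  obtain ⟨c, hc⟩ := exists_symbolMap_eq_character hS hV
  have key : ∀ θ : CommutatorPerp S, θ.toDual V = fourierCoeff hS θ.toDual c := fun θ =>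
    (apply_rho_symbolMap hS θ.toDual_mem V).symm.trans
      (congrArg (fun f => θ.toDual (rho hS f)) hc)
  rw [key ξ, key η, key ζ, h c]

lemma isDualProduct_annihilatorMul (ξ η : CommutatorPerp S) :
    IsDualProduct ξ.toDual η.toDual (annihilatorMul hS ξ η).toDual :=
  isDualProduct_of_fourierCoeff hS (fourierCoeff_annihilatorMul hS ξ η)

lemma annihilatorMul_assoc (ξ η ζ : CommutatorPerp S) :
    annihilatorMul hS (annihilatorMul hS ξ η) ζ = annihilatorMul hS ξ (annihilatorMul hS η ζ) :=
  ext_fourierCoeff hS fun c => by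
    rw [fourierCoeff_annihilatorMul, fourierCoeff_annihilatorMul, fourierCoeff_annihilatorMul,
      fourierCoeff_annihilatorMul, mul_assoc]

lemma annihilatorMul_comm (ξ η : CommutatorPerp S) :
    annihilatorMul hS ξ η = annihilatorMul hS η ξ :=
  ext_fourierCoeff hS fun c => by
    rw [fourierCoeff_annihilatorMul, fourierCoeff_annihilatorMul, mul_comm]

lemma norm_annihilatorMul_le (ξ η : CommutatorPerp S) :
    ‖annihilatorMul hS ξ η‖ ≤ ‖ξ‖ * ‖η‖ := by
  rw [annihilatorMul_apply, LinearIsometryEquiv.norm_map]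
  refine (norm_conv_le _ _).trans_eq ?_
  rw [LinearIsometryEquiv.norm_map, LinearIsometryEquiv.norm_map]

/-- Restriction of functionals along `ρ`. -/
noncomputable def precompRho : StrongDual ℂ (Cred S) →L[ℂ] FunctionalSpace Γ :=
  ContinuousLinearMap.precomp ℂ (rho hS)

/-- The projection `ξ ↦ ξ ∘ ρ ∘ σ` of the dual onto `K^⊥`. -/
noncomputable def annihilatorProj : StrongDual ℂ (Cred S) →L[ℂ] CommutatorPerp S :=
  ((annihilatorEquiv hS).symm.toContinuousLinearEquiv :
    FunctionalSpace Γ →L[ℂ] CommutatorPerp S) ∘L precompRho hS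

lemma fourierCoeff_annihilatorProj (ξ : StrongDual ℂ (Cred S)) (c : Γ) :
    fourierCoeff hS (annihilatorProj hS ξ).toDual c = fourierCoeff hS ξ c :=
  toDual_annihilatorEquiv_symm hS (precompRho hS ξ) (character c)

lemma annihilatorProj_toDual (ξ : CommutatorPerp S) : annihilatorProj hS ξ.toDual = ξ :=
  ext_fourierCoeff hS (fourierCoeff_annihilatorProj hS ξ.toDual)

lemma mem_annihilator_range_rho_iff (ξ : StrongDual ℂ (Cred S)) :
    ξ ∈ annihilator (LinearMap.range (rho hS).toLinearMap) ↔ ∀ c, fourierCoeff hS ξ c = 0 := by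
  constructor
  · exact fun h c => h _ ⟨character c, rfl⟩
  · rintro h _ ⟨f, rfl⟩
    have : ξ ∘L rho hS = 0 := ext_character h
    exact congrArg (fun Λ => Λ f) this

lemma annihilatorProj_eq_zero_iff (ξ : StrongDual ℂ (Cred S)) : annihilatorProj hS ξ = 0 ↔
    ξ ∈ annihilator (LinearMap.range (rho hS).toLinearMap) := by
  refine Iff.trans ⟨fun h c => ?_, fun h => ?_⟩ (mem_annihilator_range_rho_iff hS ξ).symm
  · rw [← fourierCoeff_annihilatorProj, h]
    rfl
  · exact ext_fourierCoeff hS fun c => (fourierCoeff_annihilatorProj hS ξ c).trans (h c)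

/-- Each `ρ(χ^c)` is itself a monomial, so the product of the dual multiplies Fourier
coefficients even outside `K^⊥`. -/
lemma fourierCoeff_of_isDualProduct {ξ η ζ : StrongDual ℂ (Cred S)} (h : IsDualProduct ξ η ζ)
    (c : Γ) : fourierCoeff hS ζ c = fourierCoeff hS ξ c * fourierCoeff hS η c :=
  (isDualProduct_iff ξ η ζ).1 h _ (rho_character_mem_monomials hS c)

lemma annihilatorProj_eq_mul {ξ η ζ : StrongDual ℂ (Cred S)} (h : IsDualProduct ξ η ζ) :
    annihilatorProj hS ζ = annihilatorMul hS (annihilatorProj hS ξ) (annihilatorProj hS η) :=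
  ext_fourierCoeff hS fun c => by
    rw [fourierCoeff_annihilatorMul, fourierCoeff_annihilatorProj, fourierCoeff_annihilatorProj,
      fourierCoeff_annihilatorProj, fourierCoeff_of_isDualProduct hS h]

lemma mem_annihilator_range_rho_of_isDualProduct {ξ η ζ : StrongDual ℂ (Cred S)}
    (h : IsDualProduct ξ η ζ)
    (hξη : ξ ∈ annihilator (LinearMap.range (rho hS).toLinearMap) ∨
      η ∈ annihilator (LinearMap.range (rho hS).toLinearMap)) :
    ζ ∈ annihilator (LinearMap.range (rho hS).toLinearMap) := by
  refine (mem_annihilator_range_rho_iff hS ζ).2 fun c => ?_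
  rw [fourierCoeff_of_isDualProduct hS h]
  rcases hξη with h0 | h0
  · rw [(mem_annihilator_range_rho_iff hS ξ).1 h0 c, zero_mul]
  · rw [(mem_annihilator_range_rho_iff hS η).1 h0 c, mul_zero]

variable (Γ) in
/-- The Riesz representation theorem for the dual group. -/
noncomputable def rieszDualGroup : RegularMeasure (DualGroup Γ) ≃ₗᵢ[ℂ] FunctionalSpace Γ :=
  rieszEquiv (DualGroup Γ)

/-- The identification of `K^⊥` with `M(G)`. -/
noncomputable def annihilatorMeasureEquiv :
    CommutatorPerp S ≃ₗᵢ[ℂ] RegularMeasure (DualGroup Γ) :=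
  (annihilatorEquiv hS).trans (rieszDualGroup Γ).symm

lemma cintegral_annihilatorMeasureEquiv (ξ : CommutatorPerp S) (f : C(DualGroup Γ, ℂ)) :
    cintegral (annihilatorMeasureEquiv hS ξ) f = ξ.toDual (rho hS f) :=
  congrArg (fun Λ => FunctionalSpace.eval Λ f)
    ((rieszDualGroup Γ).apply_symm_apply (annihilatorEquiv hS ξ))

lemma isConvolution_annihilatorMul (ξ η : CommutatorPerp S) :
    IsConvolution (annihilatorMeasureEquiv hS ξ) (annihilatorMeasureEquiv hS η)
      (annihilatorMeasureEquiv hS (annihilatorMul hS ξ η)) := by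
  intro f
  have h : (fun x => cintegral (annihilatorMeasureEquiv hS η) fun y => f (x * y)) =
      sliceMap (annihilatorEquiv hS η) f :=
    funext fun x => cintegral_annihilatorMeasureEquiv hS η (translates f x)
  calc cintegral (annihilatorMeasureEquiv hS (annihilatorMul hS ξ η)) f
      = (annihilatorMul hS ξ η).toDual (rho hS f) :=
        cintegral_annihilatorMeasureEquiv hS (annihilatorMul hS ξ η) f
    _ = (conv (annihilatorEquiv hS ξ) (annihilatorEquiv hS η)).eval f :=
        toDual_annihilatorEquiv_symm hS _ f
    _ = ξ.toDual (rho hS (sliceMap (annihilatorEquiv hS η) f)) := rfl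
    _ = cintegral (annihilatorMeasureEquiv hS ξ) (sliceMap (annihilatorEquiv hS η) f) :=
        (cintegral_annihilatorMeasureEquiv hS ξ _).symm
    _ = _ := congrArg (cintegral (annihilatorMeasureEquiv hS ξ)) h.symm

include hS in
lemma completeSpace_commutatorPerp : CompleteSpace (CommutatorPerp S) :=
  (annihilatorEquiv hS).toIsometryEquiv.completeSpace

lemma exact_subtypeL {E F : Type*} [AddCommGroup E] [Module ℂ E] [TopologicalSpace E] [Zero F]
    {N : Submodule ℂ E} {g : E → F} (h : ∀ x, g x = 0 ↔ x ∈ N) :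
    Function.Exact N.subtypeL g := fun x =>
  (h x).trans ⟨fun hx => ⟨⟨x, hx⟩, rfl⟩, fun ⟨y, hy⟩ => hy ▸ y.2⟩

lemma exact_subtypeL_annihilatorProj :
    Function.Exact (annihilator (LinearMap.range (rho hS).toLinearMap)).subtypeL
      (annihilatorProj hS) :=
  exact_subtypeL (annihilatorProj_eq_zero_iff hS)

end Dual

end SemigroupCstar

theorem theorem13 {Γ : Type*} [AddCommGroup Γ] [TopologicalSpace Γ] [DiscreteTopology Γ]
    (S : AddSubmonoid Γ) (hS : ∀ c : Γ, ∃ a ∈ S, ∃ b ∈ S, c = a - b) :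
    -- the product of `K^⊥`, the isomorphism `K^⊥ ≅ M(G)`, and the map of the dual onto `K^⊥`
    ∃ (mul : annihilator (commutatorIdeal S) →ₗ[ℂ] annihilator (commutatorIdeal S) →ₗ[ℂ]
          annihilator (commutatorIdeal S))
      (Φ : annihilator (commutatorIdeal S) ≃ₗᵢ[ℂ] RegularMeasure (DualGroup Γ))
      (π : StrongDual ℂ (Cred S) →L[ℂ] annihilator (commutatorIdeal S)),
      -- `K^⊥` is a (commutative) Banach algebra under the product of the dual
      CompleteSpace (annihilator (commutatorIdeal S)) ∧
      (∀ ξ η : annihilator (commutatorIdeal S), IsDualProduct ξ.1 η.1 (mul ξ η).1) ∧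
      (∀ ξ η ζ, mul (mul ξ η) ζ = mul ξ (mul η ζ)) ∧
      (∀ ξ η, mul ξ η = mul η ξ) ∧
      (∀ ξ η, ‖mul ξ η‖ ≤ ‖ξ‖ * ‖η‖) ∧
      -- `Φ` is the isomorphism with the measure algebra under convolution
      (∀ ξ η, IsConvolution (Φ ξ) (Φ η) (Φ (mul ξ η))) ∧
      (∀ (ξ : annihilator (commutatorIdeal S)) (f : C(DualGroup Γ, ℂ)),
        (ξ : StrongDual ℂ (Cred S)) (rho hS f) = cintegral (Φ ξ) f) ∧
      -- the sequence `0 → ρ(C(G))^⊥ → (C*_red(S))^* → K^⊥ → 0` is exact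
      Function.Injective (annihilator (LinearMap.range (rho hS).toLinearMap)).subtypeL ∧
      Function.Exact (annihilator (LinearMap.range (rho hS).toLinearMap)).subtypeL π ∧
      Function.Surjective π ∧
      -- and it is split by the inclusion of `K^⊥`
      (∀ ξ : annihilator (commutatorIdeal S), π ξ = ξ) ∧
      -- compatibility with the product of the dual
      (∀ ξ η ζ : StrongDual ℂ (Cred S), IsDualProduct ξ η ζ → π ζ = mul (π ξ) (π η)) ∧
      (∀ ξ η ζ : StrongDual ℂ (Cred S), IsDualProduct ξ η ζ →
        ξ ∈ annihilator (LinearMap.range (rho hS).toLinearMap) ∨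
          η ∈ annihilator (LinearMap.range (rho hS).toLinearMap) →
        ζ ∈ annihilator (LinearMap.range (rho hS).toLinearMap)) := by
  exact ⟨annihilatorMul hS, annihilatorMeasureEquiv hS, annihilatorProj hS,
    completeSpace_commutatorPerp hS, isDualProduct_annihilatorMul hS, annihilatorMul_assoc hS,
    annihilatorMul_comm hS, norm_annihilatorMul_le hS, isConvolution_annihilatorMul hS,
    fun ξ f => (cintegral_annihilatorMeasureEquiv hS ξ f).symm, Subtype.val_injective,
    exact_subtypeL_annihilatorProj hS, fun ξ => ⟨ξ.1, annihilatorProj_toDual hS ξ⟩,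
    annihilatorProj_toDual hS, fun _ _ _ h => annihilatorProj_eq_mul hS h,
    fun _ _ _ h => mem_annihilator_range_rho_of_isDualProduct hS h⟩
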